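/- Let $\Bbbk$ be a field and $n\ge 0$, and let $Q$ be the quiver $1\to 2\to\cdots\to n$. A finite-dimensional representation $V$ of $Q$ over $\Bbbk$ is \emph{exceptional} if $\operatorname{End}(V)$ is a division ring and $\operatorname{Ext}^m(V,V)=0$ for all $m\ge 1$. A (complete) \emph{exceptional set} is a set $E$ of $n$ isomorphism classes of exceptional representations which can be ordered as $V_1,\dots,V_n$ with $\operatorname{Hom}(V_i,V_j)=0=\operatorname{Ext}^1(V_i,V_j)$ for all $j<i$. For $0\le i<j\le n$ let $M_{i,j}$ be the indecomposable representation with support $(i,j]$. The strand diagram of $E$ is the graph with vertices $0,1,\dots,n$ and one edge (strand) $c(i,j)$ for each $M_{i,j}\in E$; a strand $c(i,j)$, $i<j$, is oriented to the right if $i$ is closer to the vertex $0$ than $j$ in this graph, and to the left if $j$ is closer to $0$. For an object $X=M_{i,j}$ of $E$ define its children in $E$, whenever they exist, as follows. - If $c(i,j)$ is oriented to the right: $Xa=M_{i,x}\in E$ with $i<x<j$ and $x$ maximal; $Xb=M_{y,j}\in E$ with $i<y<j$ and $y$ minimal; $Xc=M_{j,z}\in E$ with $z>j$ and $z$ maximal.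 - If $c(i,j)$ is oriented to the left: $Xa=M_{x,j}\in E$ with $i<x<j$ and $x$ minimal; $Xb=M_{i,y}\in E$ with $i<y<j$ and $y$ maximal; $Xc=M_{z,i}\in E$ with $z<i$ and $z$ minimal. Then there is a bijection $\Phi$ from the set of exceptional sets to the set of rooted plane ternary trees with $n$ nodes (each node has a left, a middle and a right child, each of which is a node or a leaf), such that for every exceptional set $E$ the tree $\Phi(E)$ has $2n+1$ leaves, and there is a unique bijection from the nodes of $\Phi(E)$ to the objects of $E$ such that the root node (if $n\ge1$) is labeled with the object $M_{0,r}\in E$ with $r$ maximal, and the left, middle and right children of the node labeled $X$ are the nodes labeled $Xa$, $Xb$, $Xc$ respectively, a child being a leaf exactly when the corresponding object does not exist. -/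

import Mathlib

open CategoryTheory

universe u

namespace StraightA

/-- Vertices `1, …, n` of the quiver `1 → 2 → ⋯ → n`. -/
@[ext]
structure Vertex (n : ℕ) : Type where
  val : ℕ
  one_le : 1 ≤ val
  le_n : val ≤ n

/-- The quiver of type `A_n` with straight orientation: exactly one arrow `i ⟶ i + 1`
for `1 ≤ i < n`, and no other arrow. -/
instance (n : ℕ) : Quiver.{0} (Vertex n) where
  Hom v w := PLift (v.val + 1 = w.val)

/-- Representations over `k` of the quiver `1 → 2 → ⋯ → n`: functors from its path category to
`k`-vector spaces. Finite-dimensionality is imposed in `IsExceptional`. -/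
abbrev Rep (k : Type u) [Field k] (n : ℕ) : Type (u + 1) :=
  Paths (Vertex n) ⥤ ModuleCat.{u} k

/-- `Ext`-groups of representations are available. -/
instance (k : Type u) [Field k] (n : ℕ) : HasExt.{u + 1} (Rep k n) :=
  HasExt.standard _

/-- A representation is exceptional if it is finite-dimensional, its endomorphism ring is a
division ring, and it has no self-extensions in positive degrees. -/
structure IsExceptional {k : Type u} [Field k] {n : ℕ} (V : Rep k n) : Prop where
  finite : ∀ v : Paths (Vertex n), Module.Finite k (V.obj v)
  nontrivial_end : Nontrivial (End V)
  isUnit_end : ∀ f : End V, f ≠ 0 → IsUnit f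
  ext_self : ∀ m : ℕ, 1 ≤ m → Subsingleton (Abelian.Ext.{u + 1} V V m)

/-- An exceptional sequence `(V_1, …, V_m)`: exceptional representations with
`Hom(V_i, V_j) = 0 = Ext^1(V_i, V_j)` for all `j < i`. -/
structure IsExceptionalSequence {k : Type u} [Field k] {n m : ℕ} (V : Fin m → Rep k n) :
    Prop where
  exceptional : ∀ i, IsExceptional (V i)
  hom_eq_zero : ∀ i j, j < i → Subsingleton (V i ⟶ V j)
  ext_eq_zero : ∀ i j, j < i → Subsingleton (Abelian.Ext.{u + 1} (V i) (V j) 1)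

/-- Isomorphism classes of representations of the quiver `1 → 2 → ⋯ → n`. -/
abbrev IsoClass (k : Type u) [Field k] (n : ℕ) : Type (u + 1) :=
  Quotient (isIsomorphicSetoid (Rep k n))

/-- The isomorphism class of a representation. -/
abbrev isoClass {k : Type u} [Field k] {n : ℕ} (V : Rep k n) : IsoClass k n :=
  Quotient.mk (isIsomorphicSetoid (Rep k n)) V

/-- A (complete) exceptional set: the set of isomorphism classes of the members of an exceptional
sequence whose length is the number `n` of vertices. -/
def IsExceptionalSet {k : Type u} [Field k] {n : ℕ} (S : Set (IsoClass k n)) : Prop :=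
  ∃ V : Fin n → Rep k n, IsExceptionalSequence V ∧ S = Set.range fun i => isoClass (V i)

/-- The interval representation `M_{i,j}`: one copy of `k` at each vertex of `(i, j]`, zero at the
other vertices, and the identity of `k` on every arrow inside `(i, j]`. -/
def intervalRep (k : Type u) [Field k] (n i j : ℕ) : Rep k n :=
  Paths.lift
    { obj := fun v => ModuleCat.of k (PLift (i < v.val ∧ v.val ≤ j) → k)
      map := fun {v _} _ => ModuleCat.ofHom <| LinearMap.pi fun _ =>
        if h : i < v.val ∧ v.val ≤ j then LinearMap.proj (PLift.up h) else 0 }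

/-- The isomorphism class of `M_{i,j}`, for `i` and `j` in `{0, …, n}`. -/
def M (k : Type u) [Field k] {n : ℕ} (i j : Fin (n + 1)) : IsoClass k n :=
  isoClass (intervalRep k n i j)

/-- `c(i, j)` with `i < j` is a strand of the strand diagram of `S`. -/
def Strand {k : Type u} [Field k] {n : ℕ} (S : Set (IsoClass k n)) (i j : Fin (n + 1)) : Prop :=
  i < j ∧ M k i j ∈ S

/-- The strand diagram of `S`, as a graph with vertices `0, …, n` and the strands as edges. -/
def strandGraph {k : Type u} [Field k] {n : ℕ} (S : Set (IsoClass k n)) :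
    SimpleGraph (Fin (n + 1)) where
  Adj i j := Strand S i j ∨ Strand S j i
  symm := ⟨fun _ _ h => h.symm⟩
  loopless := ⟨fun i h => h.elim (fun h => lt_irrefl i h.1) (fun h => lt_irrefl i h.1)⟩

/-- The strand `c(i, j)`, `i < j`, is oriented to the right: `i` is closer to the root `0`. -/
def OrientedRight {k : Type u} [Field k] {n : ℕ} (S : Set (IsoClass k n))
    (i j : Fin (n + 1)) : Prop :=
  (strandGraph S).dist 0 i < (strandGraph S).dist 0 j

/-- The strand `c(i, j)`, `i < j`, is oriented to the left: `j` is closer to the root `0`. -/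
def OrientedLeft {k : Type u} [Field k] {n : ℕ} (S : Set (IsoClass k n))
    (i j : Fin (n + 1)) : Prop :=
  (strandGraph S).dist 0 j < (strandGraph S).dist 0 i

/-- The three kinds of children `Xa`, `Xb`, `Xc`. -/
inductive Letter : Type
  | a | b | c

/-- For `X = c(i, j)` oriented to the left, `c(p, q)` is the strand `Xa`, `Xb` or `Xc`. -/
def LeftChild {k : Type u} [Field k] {n : ℕ} (S : Set (IsoClass k n)) (i j : Fin (n + 1)) :
    Letter → Fin (n + 1) → Fin (n + 1) → Prop
  | .a, p, q => q = j ∧ IsLeast {x | i < x ∧ x < j ∧ Strand S x j} p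
  | .b, p, q => p = i ∧ IsGreatest {y | i < y ∧ y < j ∧ Strand S i y} q
  | .c, p, q => q = i ∧ IsLeast {z | z < i ∧ Strand S z i} p

/-- For `X = c(i, j)` oriented to the right, `c(p, q)` is the strand `Xa`, `Xb` or `Xc`. -/
def RightChild {k : Type u} [Field k] {n : ℕ} (S : Set (IsoClass k n)) (i j : Fin (n + 1)) :
    Letter → Fin (n + 1) → Fin (n + 1) → Prop
  | .a, p, q => p = i ∧ IsGreatest {x | i < x ∧ x < j ∧ Strand S i x} q
  | .b, p, q => q = j ∧ IsLeast {y | i < y ∧ y < j ∧ Strand S y j} p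
  | .c, p, q => p = j ∧ IsGreatest {z | j < z ∧ Strand S j z} q

/-- `Y` is the object of `S` that is the child `Xd` of the object `X` of `S`. -/
def IsChild {k : Type u} [Field k] {n : ℕ} (S : Set (IsoClass k n)) (d : Letter)
    (X Y : IsoClass k n) : Prop :=
  ∃ i j p q : Fin (n + 1), Strand S i j ∧ X = M k i j ∧ Y = M k p q ∧
    ((OrientedLeft S i j ∧ LeftChild S i j d p q) ∨
      (OrientedRight S i j ∧ RightChild S i j d p q))

/-- `X` is the root object of `S`: the injective object `M_{0,r}` of `S` with `r` maximal. -/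
def IsRoot {k : Type u} [Field k] {n : ℕ} (S : Set (IsoClass k n)) (X : IsoClass k n) : Prop :=
  ∃ r : Fin (n + 1), IsGreatest {x | Strand S 0 x} r ∧ X = M k 0 r

/-- Rooted (plane) ternary trees: a leaf, or a node with a left, a middle and a right subtree. -/
inductive TernaryTree : Type
  | leaf : TernaryTree
  | node : TernaryTree → TernaryTree → TernaryTree → TernaryTree

namespace TernaryTree

/-- The number of (internal) nodes. -/
def numNodes : TernaryTree → ℕ
  | leaf => 0
  | node x y z => x.numNodes + y.numNodes + z.numNodes + 1

/-- The number of leaves. -/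
def numLeaves : TernaryTree → ℕ
  | leaf => 1
  | node x y z => x.numLeaves + y.numLeaves + z.numLeaves

/-- The word `w` describes the path from the root to an (internal) node of the tree; the letters
`a`, `b`, `c` stand for a step to the left, middle and right child. -/
def IsNode : TernaryTree → List Letter → Prop
  | leaf, _ => False
  | node _ _ _, [] => True
  | node x _ _, .a :: w => x.IsNode w
  | node _ y _, .b :: w => y.IsNode w
  | node _ _ z, .c :: w => z.IsNode w

/-- The nodes of the tree, given by their words. -/
abbrev Node (T : TernaryTree) : Type := {w : List Letter // T.IsNode w}

end TernaryTree

/-- `ℓ` labels the nodes of `T` by the objects of `S` according to the rule for children: the root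
node carries the root object, and for every node `w` with label `X` and every letter `d`, the
object `Xd` (if it exists) is the label of the child `wd`, which is a leaf if `Xd` does not
exist. -/
structure IsChildrenLabelling {k : Type u} [Field k] {n : ℕ} (S : Set (IsoClass k n))
    (T : TernaryTree) (ℓ : T.Node ≃ S) : Prop where
  root : ∀ h : T.IsNode [], IsRoot S (ℓ ⟨[], h⟩).1
  child : ∀ (w : T.Node) (d : Letter) (Y : S),
    IsChild S d (ℓ w).1 Y.1 ↔ ∃ h : T.IsNode (w.1 ++ [d]), ℓ ⟨w.1 ++ [d], h⟩ = Y

end StraightA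

namespace StraightA

/-! Up to isomorphism the exceptional representations are the intervals `M_{i,j}` with `i < j ≤ n`
(`IsExceptional.exists_iso_intervalRep`, `isExceptional_intervalRep`). Moreover `Hom(M_{i,j},
M_{p,q})` is nonzero exactly when `p ≤ i < q ≤ j`, and `Ext^1(M_{i,j}, M_{p,q})` exactly when `i < p
≤ j < q`. The two cases of `Blocks X Y` are thus a nonzero Hom and a nonzero Ext from `Y` to `X`,
and an exceptional set amounts to `n` arcs on the vertices `0, …, n` that can be ordered so that no
arc blocks a later one.

The inverse of the bijection draws a tree as such a set of arcs. Write `|T|` for the number of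
nodes. To draw `node A B C` from a vertex `s` in direction `σ`, let the root strand run from `s` to
`t = s + σ(|A| + |B| + 1)`, draw `A` from `s` towards `t`, `B` from `t` back towards `s`, and `C`
from `t` onwards. One unit step between `A` and `B` stays empty, so the tree fills `|T| + 1`
consecutive vertices, and each of them except `s` is the far end of exactly one strand. Listing `B`,
root, `A`, `C` (or `A`, `C`, root, `B` if `σ = -1`) gives an exceptional sequence (`pairwise_arcs`).

The drawing obeys the children rule: `depth` is the distance from the vertex `0`, so `σ` is the
orientation, and the root of each subtree is its longest strand at the starting vertex
(`label_child`, `exists_labelling`). As the rule determines root and children uniquely, the tree and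
its labelling can be read off from the set, which gives injectivity. Surjectivity is `drawable`: the
longest arc at an end vertex separates `C` from the rest, and the arcs below it leave a gap that
separates `A` from `B` (`exists_gap`). -/

/-- The arc `X` may not precede the arc `Y` in an exceptional sequence. -/
def Blocks (X Y : ℤ × ℤ) : Prop :=
  (X.1 ≤ Y.1 ∧ Y.1 < X.2 ∧ X.2 ≤ Y.2) ∨ (Y.1 < X.1 ∧ X.1 ≤ Y.2 ∧ Y.2 < X.2)

/-- The arc underlying an oriented strand. -/
def arc (p : ℤ × ℤ) : ℤ × ℤ := (min p.1 p.2, max p.1 p.2)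

/-! ### Drawing a ternary tree as a strand diagram. -/

namespace TernaryTree

/-- The far end of the strand at the root of `node A B C`, if its near end is `s` and it points in
the direction of the sign `σ`. -/
def rootFar (A B : TernaryTree) (σ s : ℤ) : ℤ := s + σ * (A.numNodes + B.numNodes + 1)

/-- The strand, as a pair of its near end and its far end, at a node of the tree that is drawn
from the vertex `s` on in the direction of the sign `σ`. -/
def label : TernaryTree → ℤ → ℤ → List Letter → ℤ × ℤ
  | leaf, _, s, _ => (s, s)
  | node A B _, σ, s, [] => (s, rootFar A B σ s)
  | node A _ _, σ, s, .a :: w => A.label σ s w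
  | node A B _, σ, s, .b :: w => B.label (-σ) (rootFar A B σ s) w
  | node A B C, σ, s, .c :: w => C.label σ (rootFar A B σ s) w

/-- The distance of the vertex `v` from `s` in the strand diagram that the tree describes. -/
def depth : TernaryTree → ℤ → ℤ → ℤ → ℕ
  | leaf, _, _, _ => 0
  | node A B C, σ, s, v =>
    if σ * (v - s) ≤ A.numNodes then A.depth σ s v
    else if σ * (v - rootFar A B σ s) ≤ 0 then B.depth (-σ) (rootFar A B σ s) v + 1
    else C.depth σ (rootFar A B σ s) v + 1

/-- The arcs of the strand diagram that the tree describes, in the order of an exceptional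
sequence. -/
def arcs : TernaryTree → ℤ → ℤ → List (ℤ × ℤ)
  | leaf, _, _ => []
  | node A B C, σ, s =>
    if 0 < σ then
      B.arcs (-σ) (rootFar A B σ s) ++
        arc (s, rootFar A B σ s) :: (A.arcs σ s ++ C.arcs σ (rootFar A B σ s))
    else
      A.arcs σ s ++ C.arcs σ (rootFar A B σ s) ++
        arc (s, rootFar A B σ s) :: B.arcs (-σ) (rootFar A B σ s)

theorem numLeaves_eq (T : TernaryTree) : T.numLeaves = 2 * T.numNodes + 1 := by
  induction T with
  | leaf => rfl
  | node A B C hA hB hC => simp only [numLeaves, numNodes]; omega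

/-- Strands stay in the range of vertices that their tree fills. As the ranges of the three subtrees
meet at most at `t = rootFar A B σ s`, this is what lets `omega` exclude strands from the wrong
subtree later on. -/
theorem label_bounds (T : TernaryTree) {σ : ℤ} (hσ : σ = 1 ∨ σ = -1) (s : ℤ) {w : List Letter}
    (hw : T.IsNode w) :
    0 < σ * ((T.label σ s w).2 - s) ∧ σ * ((T.label σ s w).2 - s) ≤ T.numNodes ∧
      0 ≤ σ * ((T.label σ s w).1 - s) ∧ σ * ((T.label σ s w).1 - s) ≤ T.numNodes ∧
      (T.label σ s w).1 ≠ (T.label σ s w).2 := by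
  induction T generalizing σ s w with
  | leaf => exact hw.elim
  | node A B C hA hB hC =>
    have hσ' : -σ = 1 ∨ -σ = -1 := by omega
    rcases w with _ | ⟨d, w⟩
    · rcases hσ with rfl | rfl <;> simp only [label, numNodes, rootFar] <;> push_cast <;> omega
    · cases d
      · have := hA hσ s hw
        rcases hσ with rfl | rfl <;> simp only [label, numNodes] at * <;> push_cast at * <;> omega
      · have := hB hσ' (rootFar A B σ s) hw
        rcases hσ with rfl | rfl <;> simp only [label, numNodes, rootFar] at * <;>
          push_cast at * <;> omega
      · have := hC hσ (rootFar A B σ s) hw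
        rcases hσ with rfl | rfl <;> simp only [label, numNodes, rootFar] at * <;>
          push_cast at * <;> omega

/-- Going from `s`, the far ends in `A`, the far ends in `B`, the vertex `t` and the far ends in `C`
fill disjoint ranges; `B` is drawn backwards from `t`, so `t` is not a far end in `B`. With
`exists_label_snd_eq`, nodes correspond to vertices other than `s`. -/
theorem label_snd_injective (T : TernaryTree) {σ : ℤ} (hσ : σ = 1 ∨ σ = -1) (s : ℤ)
    {w w' : List Letter} (hw : T.IsNode w) (hw' : T.IsNode w')
    (h : (T.label σ s w).2 = (T.label σ s w').2) : w = w' := by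
  induction T generalizing σ s w w' with
  | leaf => exact hw.elim
  | node A B C hA hB hC =>
    have hσ' : -σ = 1 ∨ -σ = -1 := by omega
    have bA := fun v (hv : A.IsNode v) => A.label_bounds hσ s hv
    have bB := fun v (hv : B.IsNode v) => B.label_bounds hσ' (rootFar A B σ s) hv
    have bC := fun v (hv : C.IsNode v) => C.label_bounds hσ (rootFar A B σ s) hv
    have ht : rootFar A B σ s = s + σ * (A.numNodes + B.numNodes + 1) := rfl
    rcases w with _ | ⟨_ | _ | _, w⟩ <;> rcases w' with _ | ⟨_ | _ | _, w'⟩ <;>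
      simp only [label, IsNode] at hw hw' h <;>
      first
      | rfl
      | rw [hA hσ _ hw hw' h]
      | rw [hB hσ' _ hw hw' h]
      | rw [hC hσ _ hw hw' h]
      | exfalso
        try replace bA := And.intro (bA _ ‹_›) trivial
        try replace bB := And.intro (bB _ ‹_›) trivial
        try replace bC := And.intro (bC _ ‹_›) trivial
        rcases hσ with rfl | rfl <;> omega

theorem exists_label_snd_eq (T : TernaryTree) {σ : ℤ} (hσ : σ = 1 ∨ σ = -1) (s v : ℤ)
    (h0 : 0 < σ * (v - s)) (h1 : σ * (v - s) ≤ T.numNodes) :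
    ∃ w, T.IsNode w ∧ (T.label σ s w).2 = v := by
  induction T generalizing σ s with
  | leaf => simp only [numNodes] at h1; push_cast at h1; omega
  | node A B C hA hB hC =>
    have hσ' : -σ = 1 ∨ -σ = -1 := by omega
    have ht : rootFar A B σ s = s + σ * (A.numNodes + B.numNodes + 1) := rfl
    simp only [numNodes] at h1
    push_cast at h1
    by_cases h2 : σ * (v - s) ≤ A.numNodes
    · obtain ⟨w, hw, h⟩ := hA hσ s h0 h2
      exact ⟨.a :: w, hw, h⟩
    by_cases h3 : v = rootFar A B σ s
    · exact ⟨[], trivial, h3.symm⟩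
    by_cases h4 : 0 < -σ * (v - rootFar A B σ s)
    · obtain ⟨w, hw, h⟩ := hB hσ' _ h4 (by rcases hσ with rfl | rfl <;> omega)
      exact ⟨.b :: w, hw, h⟩
    · obtain ⟨w, hw, h⟩ := hC hσ (rootFar A B σ s) (by rcases hσ with rfl | rfl <;> omega)
        (by rcases hσ with rfl | rfl <;> omega)
      exact ⟨.c :: w, hw, h⟩

theorem depth_self (T : TernaryTree) (σ s : ℤ) : T.depth σ s s = 0 := by
  induction T generalizing σ s with
  | leaf => rfl
  | node A B C hA hB hC => rw [depth, if_pos (by simp), hA]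

theorem depth_label (T : TernaryTree) {σ : ℤ} (hσ : σ = 1 ∨ σ = -1) (s : ℤ) {w : List Letter}
    (hw : T.IsNode w) :
    T.depth σ s (T.label σ s w).2 = T.depth σ s (T.label σ s w).1 + 1 := by
  induction T generalizing σ s w with
  | leaf => exact hw.elim
  | node A B C hA hB hC =>
    have hσ' : -σ = 1 ∨ -σ = -1 := by omega
    have ht : rootFar A B σ s = s + σ * (A.numNodes + B.numNodes + 1) := rfl
    rcases w with _ | ⟨d, w⟩
    · rw [label, depth_self, depth, if_neg (by rcases hσ with rfl | rfl <;> omega),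
        if_pos (by simp), depth_self]
    cases d
    · have := A.label_bounds hσ s hw
      specialize hA hσ s hw
      rw [label]
      generalize A.label σ s w = p at *
      rw [depth, depth, if_pos this.2.1, if_pos this.2.2.2.1, hA]
    · have := B.label_bounds hσ' (rootFar A B σ s) hw
      specialize hB hσ' (rootFar A B σ s) hw
      rw [label]
      generalize B.label (-σ) (rootFar A B σ s) w = p at *
      rw [depth, depth, if_neg (by rcases hσ with rfl | rfl <;> omega),
        if_pos (by rcases hσ with rfl | rfl <;> omega),
        if_neg (by rcases hσ with rfl | rfl <;> omega),
        if_pos (by rcases hσ with rfl | rfl <;> omega), hB]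
    · have := C.label_bounds hσ (rootFar A B σ s) hw
      specialize hC hσ (rootFar A B σ s) hw
      rw [label]
      generalize C.label σ (rootFar A B σ s) w = p at *
      rw [depth, depth, if_neg (by rcases hσ with rfl | rfl <;> omega),
        if_neg (by rcases hσ with rfl | rfl <;> omega),
        if_neg (by rcases hσ with rfl | rfl <;> omega), hC]
      -- The vertex where `C` starts is sent to the `B` branch by `depth`; this is harmless because
      -- it has depth `0` in both subtrees.
      by_cases h : p.1 = rootFar A B σ s
      · rw [h, if_pos (by simp), depth_self, depth_self]
      · rw [if_neg (by rcases hσ with rfl | rfl <;> omega)]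

theorem label_nil_fst (T : TernaryTree) (σ s : ℤ) : (T.label σ s []).1 = s := by
  cases T <;> rfl

/-- Apart from the root strand, only strands of `A` can have near end `s`, and these end before `t`.
Applied to each subtree, this makes its root the extremal candidate in the children rule. -/
theorem label_snd_le (T : TernaryTree) {σ : ℤ} (hσ : σ = 1 ∨ σ = -1) (s : ℤ) {w : List Letter}
    (hw : T.IsNode w) (h : (T.label σ s w).1 = s) :
    σ * ((T.label σ s w).2 - s) ≤ σ * ((T.label σ s []).2 - s) := by
  cases T with
  | leaf => exact hw.elim
  | node A B C =>
    have hσ' : -σ = 1 ∨ -σ = -1 := by omega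
    have ht : rootFar A B σ s = s + σ * (A.numNodes + B.numNodes + 1) := rfl
    rcases w with _ | ⟨d, w⟩
    · exact le_rfl
    cases d
    · have := A.label_bounds hσ s hw
      simp only [label] at *
      rcases hσ with rfl | rfl <;> omega
    · have := B.label_bounds hσ' (rootFar A B σ s) hw
      simp only [label] at *
      rcases hσ with rfl | rfl <;> omega
    · have := C.label_bounds hσ (rootFar A B σ s) hw
      simp only [label] at *
      rcases hσ with rfl | rfl <;> omega

theorem length_arcs (T : TernaryTree) (σ s : ℤ) : (T.arcs σ s).length = T.numNodes := by
  induction T generalizing σ s with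
  | leaf => rfl
  | node A B C hA hB hC =>
    rw [arcs, numNodes]
    split_ifs <;> simp only [List.length_append, List.length_cons, hA, hB, hC] <;> omega

theorem mem_arcs_node {A B C : TernaryTree} {σ s : ℤ} {X : ℤ × ℤ} :
    X ∈ (node A B C).arcs σ s ↔ X = arc (s, rootFar A B σ s) ∨ X ∈ A.arcs σ s ∨
      X ∈ B.arcs (-σ) (rootFar A B σ s) ∨ X ∈ C.arcs σ (rootFar A B σ s) := by
  rw [arcs]
  split_ifs <;> simp only [List.mem_append, List.mem_cons] <;> tauto

theorem mem_arcs {T : TernaryTree} {σ s : ℤ} {X : ℤ × ℤ} :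
    X ∈ T.arcs σ s ↔ ∃ w, T.IsNode w ∧ arc (T.label σ s w) = X := by
  induction T generalizing σ s with
  | leaf => exact ⟨fun h => by simp [arcs] at h, fun ⟨w, hw, _⟩ => hw.elim⟩
  | node A B C hA hB hC =>
    rw [mem_arcs_node, hA, hB, hC]
    constructor
    · rintro (rfl | ⟨w, hw, h⟩ | ⟨w, hw, h⟩ | ⟨w, hw, h⟩)
      · exact ⟨[], trivial, rfl⟩
      · exact ⟨.a :: w, hw, h⟩
      · exact ⟨.b :: w, hw, h⟩
      · exact ⟨.c :: w, hw, h⟩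
    · rintro ⟨_ | ⟨_ | _ | _, w⟩, hw, h⟩
      · exact .inl h.symm
      · exact .inr (.inl ⟨w, hw, h⟩)
      · exact .inr (.inr (.inl ⟨w, hw, h⟩))
      · exact .inr (.inr (.inr ⟨w, hw, h⟩))

theorem arcs_bounds {T : TernaryTree} {σ s : ℤ} (hσ : σ = 1 ∨ σ = -1) {X : ℤ × ℤ}
    (hX : X ∈ T.arcs σ s) : X.1 < X.2 ∧ 0 ≤ σ * (X.1 - s) ∧ σ * (X.1 - s) ≤ T.numNodes ∧
      0 ≤ σ * (X.2 - s) ∧ σ * (X.2 - s) ≤ T.numNodes := by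
  obtain ⟨w, hw, rfl⟩ := mem_arcs.1 hX
  have := T.label_bounds hσ s hw
  simp only [arc]
  rcases hσ with rfl | rfl <;> omega

/-- For `σ = 1`, an arc of `B` ending at `t` is blocked by the root arc, while the root arc is
blocked by arcs of `A` starting at `s` and by arcs of `C` starting at `t`; this forces `B`, root,
`A`, `C`. For `σ = -1` all three relations are reversed. Arcs of different subtrees do not block
each other in the order chosen. -/
theorem pairwise_arcs (T : TernaryTree) {σ : ℤ} (hσ : σ = 1 ∨ σ = -1) (s : ℤ) :
    (T.arcs σ s).Pairwise fun X Y => ¬ Blocks X Y := by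
  induction T generalizing σ s with
  | leaf => simp [arcs]
  | node A B C hA hB hC =>
    have hσ' : -σ = 1 ∨ -σ = -1 := by omega
    have ht : rootFar A B σ s = s + σ * (A.numNodes + B.numNodes + 1) := rfl
    have bA := fun X (h : X ∈ A.arcs σ s) => arcs_bounds hσ h
    have bB := fun X (h : X ∈ B.arcs (-σ) (rootFar A B σ s)) => arcs_bounds hσ' h
    have bC := fun X (h : X ∈ C.arcs σ (rootFar A B σ s)) => arcs_bounds hσ h
    specialize hA hσ s
    specialize hB hσ' (rootFar A B σ s)
    specialize hC hσ (rootFar A B σ s)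
    have hX : arc (s, rootFar A B σ s) =
      (min s (rootFar A B σ s), max s (rootFar A B σ s)) := rfl
    rw [arcs]
    generalize rootFar A B σ s = t at *
    generalize arc (s, t) = X at *
    subst hX
    split_ifs with h
    · obtain rfl : σ = 1 := by omega
      rw [List.pairwise_append, List.pairwise_cons, List.pairwise_append]
      refine ⟨hB, ⟨?_, hA, hC, ?_⟩, ?_⟩
      · intro Y hY
        rcases List.mem_append.1 hY with hY | hY
        · have := bA Y hY
          simp only [Blocks]; omega
        · have := bC Y hY
          simp only [Blocks]; omega
      · intro X hX Y hY
        have := bA X hX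
        have := bC Y hY
        simp only [Blocks]; omega
      · intro X hX Y hY
        have := bB X hX
        rcases List.mem_cons.1 hY with rfl | hY
        · simp only [Blocks]; omega
        rcases List.mem_append.1 hY with hY | hY
        · have := bA Y hY
          simp only [Blocks]; omega
        · have := bC Y hY
          simp only [Blocks]; omega
    · obtain rfl : σ = -1 := by omega
      rw [List.pairwise_append, List.pairwise_cons, List.pairwise_append]
      refine ⟨⟨hA, hC, ?_⟩, ⟨?_, hB⟩, ?_⟩
      · intro X hX Y hY
        have := bA X hX
        have := bC Y hY
        simp only [Blocks]; omega
      · intro Y hY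
        have := bB Y hY
        simp only [Blocks]; omega
      · intro X hX Y hY
        rcases List.mem_append.1 hX with hX | hX
        · have := bA X hX
          rcases List.mem_cons.1 hY with rfl | hY
          · simp only [Blocks]; omega
          · have := bB Y hY
            simp only [Blocks]; omega
        · have := bC X hX
          rcases List.mem_cons.1 hY with rfl | hY
          · simp only [Blocks]; omega
          · have := bB Y hY
            simp only [Blocks]; omega

end TernaryTree

/-! ### The children rule, uniformly in both orientations. -/

/-- In a diagram with the strands `R`, the vertex `x` is a candidate for the far end of the child
with letter `d` of the strand from `u` to `v`, which points in the direction of the sign `σ`. -/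
def Candidate (R : ℤ → ℤ → Prop) (σ u v : ℤ) : Letter → ℤ → Prop
  | .a, x => 0 < σ * (x - u) ∧ σ * (x - u) < σ * (v - u) ∧ R u x
  | .b, x => 0 < σ * (x - u) ∧ σ * (x - u) < σ * (v - u) ∧ R v x
  | .c, x => 0 < σ * (x - v) ∧ R v x

/-- The candidate `x` is at least as good as `y`. -/
def Better (σ x y : ℤ) : Letter → Prop
  | .b => σ * x ≤ σ * y
  | _ => σ * y ≤ σ * x

/-- The near end of the child with letter `d` of the strand from `u` to `v`. -/
def childNear (u v : ℤ) : Letter → ℤ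
  | .a => u
  | _ => v

namespace TernaryTree

/-- Inside the range that the tree `T` covers, the diagram `R` consists of the strands of `T`. -/
def Draws (T : TernaryTree) (σ s : ℤ) (R : ℤ → ℤ → Prop) : Prop :=
  (∀ w, T.IsNode w → R (T.label σ s w).1 (T.label σ s w).2) ∧
    ∀ p q, R p q → 0 < σ * (q - s) → σ * (q - s) ≤ T.numNodes →
      ∃ w, T.IsNode w ∧ (T.label σ s w = (p, q) ∨ T.label σ s w = (q, p))

theorem label_nil_snd {T : TernaryTree} {σ : ℤ} (hσ : σ = 1 ∨ σ = -1) (s : ℤ)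
    (h : T.IsNode []) : T.label σ s [] = (s, (T.label σ s []).2) ∧
      0 < σ * ((T.label σ s []).2 - s) ∧ σ * ((T.label σ s []).2 - s) ≤ T.numNodes := by
  have := T.label_bounds hσ s h
  exact ⟨Prod.ext (T.label_nil_fst σ s) rfl, this.1, this.2.1⟩

theorem draws_node {A B C : TernaryTree} {σ s : ℤ} (hσ : σ = 1 ∨ σ = -1) {R : ℤ → ℤ → Prop}
    (h : (node A B C).Draws σ s R) :
    A.Draws σ s R ∧ B.Draws (-σ) (rootFar A B σ s) R ∧ C.Draws σ (rootFar A B σ s) R := by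
  have hσ' : -σ = 1 ∨ -σ = -1 := by omega
  have bA := fun v (hv : A.IsNode v) => A.label_bounds hσ s hv
  have bB := fun v (hv : B.IsNode v) => B.label_bounds hσ' (rootFar A B σ s) hv
  have bC := fun v (hv : C.IsNode v) => C.label_bounds hσ (rootFar A B σ s) hv
  have ht : rootFar A B σ s = s + σ * (A.numNodes + B.numNodes + 1) := rfl
  have hn : ((node A B C).numNodes : ℤ) = A.numNodes + B.numNodes + C.numNodes + 1 := rfl
  refine ⟨⟨fun w hw => h.1 (.a :: w) hw, fun p q hR h0 h1 => ?_⟩,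
    ⟨fun w hw => h.1 (.b :: w) hw, fun p q hR h0 h1 => ?_⟩,
    ⟨fun w hw => h.1 (.c :: w) hw, fun p q hR h0 h1 => ?_⟩⟩
  all_goals
    obtain ⟨w, hw, hl⟩ := h.2 p q hR (by rcases hσ with rfl | rfl <;> omega)
      (by rcases hσ with rfl | rfl <;> omega)
    rcases w with _ | ⟨_ | _ | _, w⟩ <;> simp only [label, IsNode] at hw hl
    all_goals
      first
      | exact ⟨w, hw, hl⟩
      | exfalso
        try replace bA := bA _ hw
        try replace bB := bB _ hw
        try replace bC := bC _ hw
        rcases hl with hl | hl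
        all_goals
          have hl1 := congrArg Prod.fst hl
          have hl2 := congrArg Prod.snd hl
          simp only at hl1 hl2
          rcases hσ with rfl | rfl <;> omega

/-- Range considerations put every strand that competes for the letter `d` into the subtree at `d`
(`key`), starting at that subtree's initial vertex. Its best representative is the root strand of
the subtree by `label_snd_le`. -/
theorem label_root_child {A B C : TernaryTree} {σ s : ℤ} (hσ : σ = 1 ∨ σ = -1)
    {R : ℤ → ℤ → Prop} (hR : ∀ p q, R p q → R q p) (h : (node A B C).Draws σ s R) (d : Letter) :
    ((node A B C).IsNode [d] → ∃ x, (node A B C).label σ s [d] =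
        (childNear s (rootFar A B σ s) d, x) ∧ Candidate R σ s (rootFar A B σ s) d x ∧
      ∀ y, Candidate R σ s (rootFar A B σ s) d y → Better σ x y d) ∧
    ∀ y, Candidate R σ s (rootFar A B σ s) d y → (node A B C).IsNode [d] := by
  have hσ' : -σ = 1 ∨ -σ = -1 := by omega
  have bA := fun v (hv : A.IsNode v) => A.label_bounds hσ s hv
  have bB := fun v (hv : B.IsNode v) => B.label_bounds hσ' (rootFar A B σ s) hv
  have bC := fun v (hv : C.IsNode v) => C.label_bounds hσ (rootFar A B σ s) hv
  have ht : rootFar A B σ s = s + σ * (A.numNodes + B.numNodes + 1) := rfl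
  have hn : ((node A B C).numNodes : ℤ) = A.numNodes + B.numNodes + C.numNodes + 1 := rfl
  have key : ∀ y, Candidate R σ s (rootFar A B σ s) d y → ∃ w, (node A B C).IsNode (d :: w) ∧
      (node A B C).label σ s (d :: w) = (childNear s (rootFar A B σ s) d, y) := by
    intro y hy
    cases d <;> simp only [Candidate] at hy
    · obtain ⟨w, hw, hl⟩ := h.2 _ y hy.2.2 hy.1 (by rcases hσ with rfl | rfl <;> omega)
      rcases w with _ | ⟨_ | _ | _, w⟩ <;> simp only [label, IsNode] at hw hl
      all_goals
        rcases hl with hl | hl <;> first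
        | exact ⟨w, hw, hl⟩
        | exfalso
          try replace bA := bA _ hw
          try replace bB := bB _ hw
          try replace bC := bC _ hw
          have hl1 := congrArg Prod.fst hl
          have hl2 := congrArg Prod.snd hl
          simp only at hl1 hl2
          rcases hσ with rfl | rfl <;> omega
    · obtain ⟨w, hw, hl⟩ := h.2 _ y hy.2.2 hy.1 (by rcases hσ with rfl | rfl <;> omega)
      rcases w with _ | ⟨_ | _ | _, w⟩ <;> simp only [label, IsNode] at hw hl
      all_goals
        rcases hl with hl | hl <;> first
        | exact ⟨w, hw, hl⟩
        | exfalso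
          try replace bA := bA _ hw
          try replace bB := bB _ hw
          try replace bC := bC _ hw
          have hl1 := congrArg Prod.fst hl
          have hl2 := congrArg Prod.snd hl
          simp only at hl1 hl2
          rcases hσ with rfl | rfl <;> omega
    · obtain ⟨w, hw, hl⟩ := h.2 y _ (hR _ _ hy.2) (by rcases hσ with rfl | rfl <;> omega)
        (by rcases hσ with rfl | rfl <;> omega)
      rcases w with _ | ⟨_ | _ | _, w⟩ <;> simp only [label, IsNode] at hw hl
      all_goals
        rcases hl with hl | hl <;> first
        | exact ⟨w, hw, hl⟩
        | exfalso
          try replace bA := bA _ hw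
          try replace bB := bB _ hw
          try replace bC := bC _ hw
          have hl1 := congrArg Prod.fst hl
          have hl2 := congrArg Prod.snd hl
          simp only at hl1 hl2
          rcases hσ with rfl | rfl <;> omega
  have hnil : ∀ {T : TernaryTree} {w}, T.IsNode w → T.IsNode [] := by
    rintro (_ | _) w hw
    · exact hw.elim
    · trivial
  refine ⟨fun hd => ?_, fun y hy => ?_⟩
  · have h1 := h.1 [d] hd
    cases d <;> simp only [IsNode] at hd
    · obtain ⟨hl, hx⟩ := label_nil_snd hσ s hd
      refine ⟨_, hl, ⟨hx.1, by rcases hσ with rfl | rfl <;> omega, ?_⟩, fun y hy => ?_⟩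
      · rwa [label, hl] at h1
      · obtain ⟨w, hw, hw'⟩ := key y hy
        simp only [label, IsNode] at hw hw'
        have := A.label_snd_le hσ s hw (congrArg Prod.fst hw')
        rw [hw'] at this
        simp only [Better]
        linarith
    · obtain ⟨hl, hx⟩ := label_nil_snd hσ' (rootFar A B σ s) hd
      refine ⟨_, hl, ⟨by rcases hσ with rfl | rfl <;> omega,
        by rcases hσ with rfl | rfl <;> omega, ?_⟩, fun y hy => ?_⟩
      · rwa [label, hl] at h1
      · obtain ⟨w, hw, hw'⟩ := key y hy
        simp only [label, IsNode] at hw hw'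
        have := B.label_snd_le hσ' _ hw (by rw [hw']; rfl)
        rw [hw'] at this
        simp only [Better]
        linarith
    · obtain ⟨hl, hx⟩ := label_nil_snd hσ (rootFar A B σ s) hd
      refine ⟨_, hl, ⟨hx.1, ?_⟩, fun y hy => ?_⟩
      · rwa [label, hl] at h1
      · obtain ⟨w, hw, hw'⟩ := key y hy
        simp only [label, IsNode] at hw hw'
        have := C.label_snd_le hσ _ hw (by rw [hw']; rfl)
        rw [hw'] at this
        simp only [Better]
        linarith
  · obtain ⟨w, hw, -⟩ := key y hy
    cases d <;> exact hnil hw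

theorem label_child {T : TernaryTree} {σ s : ℤ} (hσ : σ = 1 ∨ σ = -1)
    {R : ℤ → ℤ → Prop} (hR : ∀ p q, R p q → R q p) (h : T.Draws σ s R) {w : List Letter}
    (hw : T.IsNode w) (d : Letter) :
    ∃ τ u v, (τ = 1 ∨ τ = -1) ∧ T.label σ s w = (u, v) ∧ 0 < τ * (v - u) ∧
      (T.IsNode (w ++ [d]) → ∃ x, T.label σ s (w ++ [d]) = (childNear u v d, x) ∧
        Candidate R τ u v d x ∧ ∀ y, Candidate R τ u v d y → Better τ x y d) ∧
      ∀ y, Candidate R τ u v d y → T.IsNode (w ++ [d]) := by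
  induction T generalizing σ s w with
  | leaf => exact hw.elim
  | node A B C hA hB hC =>
    obtain ⟨dA, dB, dC⟩ := draws_node hσ h
    rcases w with _ | ⟨_ | _ | _, w⟩
    · exact ⟨σ, s, rootFar A B σ s, hσ, rfl, (label_bounds _ hσ s hw).1,
        label_root_child hσ hR h d⟩
    · exact hA hσ dA hw
    · exact hB (by omega) dB hw
    · exact hC hσ dC hw

end TernaryTree

/-! ### Maximal orderable sets of arcs come from trees. -/

/-- A set of arcs that can be ordered as in an exceptional sequence, by means of a rank. -/
def Orderable (F : Finset (ℤ × ℤ)) : Prop :=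
  ∃ ρ : ℤ × ℤ → ℤ, ∀ X ∈ F, ∀ Y ∈ F, X ≠ Y → Blocks X Y → ρ Y < ρ X

/-- The arcs in `F` join vertices of the interval `[a, b]`. -/
def Inside (F : Finset (ℤ × ℤ)) (a b : ℤ) : Prop :=
  ∀ X ∈ F, a ≤ X.1 ∧ X.1 < X.2 ∧ X.2 ≤ b

theorem Orderable.mono {F G : Finset (ℤ × ℤ)} (hF : Orderable F) (h : G ⊆ F) : Orderable G := by
  obtain ⟨ρ, hρ⟩ := hF
  exact ⟨ρ, fun X hX Y hY => hρ X (h hX) Y (h hY)⟩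

/-- Crossing arcs block each other both ways, once through Hom and once through Ext. -/
theorem Orderable.noncrossing {F : Finset (ℤ × ℤ)} (hF : Orderable F) {X Y : ℤ × ℤ} (hX : X ∈ F)
    (hY : Y ∈ F) (h1 : X.1 < Y.1) (h2 : Y.1 < X.2) (h3 : X.2 < Y.2) : False := by
  obtain ⟨ρ, hρ⟩ := hF
  have hne : X ≠ Y := by rintro rfl; omega
  have := hρ X hX Y hY hne (Or.inl ⟨h1.le, h2, h3.le⟩)
  have := hρ Y hY X hX hne.symm (Or.inr ⟨h1, h2.le, h3⟩)
  omega

/-- The two ways to draw the `m` arcs of `F` between vertices of `[a, a + m]` as a tree. -/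
def Drawable (F : Finset (ℤ × ℤ)) (a : ℤ) (m : ℕ) : Prop :=
  (∃ T : TernaryTree, T.numNodes = m ∧ ∀ X, X ∈ F ↔ X ∈ T.arcs 1 a) ∧
    ∃ T : TernaryTree, T.numNodes = m ∧ ∀ X, X ∈ F ↔ X ∈ T.arcs (-1) (a + m)

/-- If there were no gap, a chain of arcs, each starting where the previous one ends, would lead
from `a` to `b`. Its first arc ranks above `(a, b)` and ranks increase along the chain, but an arc
ending at `b` must rank below `(a, b)`. -/
theorem exists_gap {F : Finset (ℤ × ℤ)} {a b : ℤ} (hI : Inside F a b) (hF : Orderable F)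
    (hab : (a, b) ∈ F) : ∃ x, a ≤ x ∧ x < b ∧
      ∀ X ∈ F, X ≠ (a, b) → X.2 ≤ x ∨ x + 1 ≤ X.1 := by
  obtain ⟨ρ, hρ⟩ := id hF
  -- Vertices reached by such a chain and not passed over by any arc other than `(a, b)`; the
  -- greatest one is the left end of the gap.
  let good : ℤ → Prop := fun v => a ≤ v ∧ v < b ∧
    (∀ X ∈ F, X ≠ (a, b) → X.1 < v → X.2 ≤ v) ∧
      (v = a ∨ ∃ u < v, (u, v) ∈ F ∧ ρ (a, b) < ρ (u, v))
  have hne : ∃ v, good v := ⟨a, le_rfl, (hI _ hab).2.1,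
    fun X hX _ h => absurd (hI X hX).1 (by omega), .inl rfl⟩
  obtain ⟨v, ⟨hav, hvb, hv, hv'⟩, hmax⟩ := Int.exists_greatest_of_bdd (P := good)
    ⟨b, fun z hz => hz.2.1.le⟩ hne
  refine ⟨v, hav, hvb, fun X hX hXab => ?_⟩
  rcases lt_trichotomy X.1 v with h | h | h
  · exact .inl (hv X hX hXab h)
  · exfalso
    let G := F.filter fun X => X ≠ (a, b) ∧ X.1 = v
    obtain ⟨Y, hY, hYmax⟩ := G.exists_max_image (fun X => X.2)
      ⟨X, Finset.mem_filter.2 ⟨hX, hXab, h⟩⟩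
    obtain ⟨hYF, hYab, hYv⟩ := Finset.mem_filter.1 hY
    obtain ⟨y, w⟩ := Y
    obtain rfl : y = v := hYv
    have hYI := hI _ hYF
    have hr : ρ (a, b) < ρ (y, w) := by
      rcases hv' with rfl | ⟨u, hu, huv, hρu⟩
      · exact hρ _ hYF _ hab hYab (Or.inl ⟨le_rfl, hYI.2.1, hYI.2.2⟩)
      · exact hρu.trans (hρ _ hYF _ huv (by simp; omega) (Or.inr ⟨hu, le_rfl, hYI.2.1⟩))
    have hwb : w < b := by
      rcases hYI.2.2.lt_or_eq with h | rfl
      · exact h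
      exfalso
      rcases hv' with rfl | ⟨u, hu, huv, hρu⟩
      · exact hYab rfl
      · have := hρ _ hab _ hYF hYab.symm (Or.inl ⟨hav, hvb, le_rfl⟩)
        omega
    -- The longest arc `(y, w)` at `y` prolongs the chain: no arc passes over `w`, by maximality for
    -- arcs starting at `y` and by noncrossing for those starting between `y` and `w`.
    have := hmax w ⟨by have := hYI.2.1; simp only at this; omega, hwb, fun Z hZ hZab hZw => ?_,
      .inr ⟨y, hYI.2.1, hYF, hr⟩⟩
    · have := hYI.2.1
      simp only at this
      omega
    · rcases lt_trichotomy Z.1 y with h | h | h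
      · exact (hv Z hZ hZab h).trans hYI.2.1.le
      · exact hYmax Z (Finset.mem_filter.2 ⟨hZ, hZab, h⟩)
      · by_contra! hlt
        exact hF.noncrossing hYF hZ h hZw hlt
  · exact .inr h

theorem card_split {F : Finset (ℤ × ℤ)} (p : ℤ × ℤ → Prop) [DecidablePred p] :
    F.card = (F.filter p).card + (F.filter fun X => ¬ p X).card :=
  (Finset.card_filter_add_card_filter_not p).symm

/-- The gap from `x` to `x + 1` cuts the arcs below `(a, a + m)` into sets on intervals of lengths
`l` and `r` with `l + 1 + r = m`. The bounds add up, so equality for `F` forces equality on both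
sides. -/
theorem drawable_of_forall_lt {m : ℕ}
    (ih : ∀ m' < m, ∀ (a : ℤ) (F : Finset (ℤ × ℤ)), Inside F a (a + m') → Orderable F →
      F.card ≤ m' ∧ (F.card = m' → Drawable F a m'))
    {a : ℤ} {F : Finset (ℤ × ℤ)} (hI : Inside F a (a + m)) (hF : Orderable F)
    (hab : (a, a + (m : ℤ)) ∈ F) :
    F.card ≤ m ∧ (F.card = m → ∃ A B : TernaryTree, A.numNodes + B.numNodes + 1 = m ∧
      ∀ X, X ∈ F ↔ X = (a, a + (m : ℤ)) ∨ X ∈ A.arcs 1 a ∨ X ∈ B.arcs (-1) (a + m)) := by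
  obtain ⟨x, hax, hxb, hx⟩ := exists_gap hI hF hab
  obtain ⟨l, rfl⟩ : ∃ l : ℕ, x = a + l := ⟨(x - a).toNat, by omega⟩
  obtain ⟨r, rfl⟩ : ∃ r : ℕ, m = l + 1 + r := ⟨m - l - 1, by omega⟩
  set E := F.erase (a, a + ((l + 1 + r : ℕ) : ℤ)) with hE
  have hEF : E ⊆ F := Finset.erase_subset _ _
  have hcard : E.card + 1 = F.card := Finset.card_erase_add_one hab
  have hsplit := card_split (F := E) fun X => X.2 ≤ a + l
  have hx' : ∀ X ∈ E, X.2 ≤ a + l ∨ a + l + 1 ≤ X.1 := fun X hX =>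
    hx X (hEF hX) (Finset.ne_of_mem_erase hX)
  have h1 := ih l (by omega) a (E.filter fun X => X.2 ≤ a + l)
    (fun X hX => by
      obtain ⟨hX, h⟩ := Finset.mem_filter.1 hX
      have := hI X (hEF hX)
      omega) (hF.mono ((Finset.filter_subset _ _).trans hEF))
  have h2 := ih r (by omega) (a + l + 1) (E.filter fun X => ¬ X.2 ≤ a + l)
    (fun X hX => by
      obtain ⟨hX, h⟩ := Finset.mem_filter.1 hX
      have := hI X (hEF hX)
      have := hx' X hX
      push_cast at *
      omega) (hF.mono ((Finset.filter_subset _ _).trans hEF))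
  refine ⟨by omega, fun hm => ?_⟩
  obtain ⟨⟨A, hA, hAF⟩, -⟩ := h1.2 (by omega)
  obtain ⟨-, B, hB, hBF⟩ := h2.2 (by omega)
  refine ⟨A, B, by omega, fun X => ?_⟩
  rw [← hAF, show a + ((l + 1 + r : ℕ) : ℤ) = a + l + 1 + r by push_cast; ring, ← hBF,
    Finset.mem_filter, Finset.mem_filter, hE, Finset.mem_erase]
  have : a + ((l + 1 + r : ℕ) : ℤ) = a + l + 1 + r := by push_cast; ring
  rw [this] at hab ⊢
  by_cases hXab : X = (a, a + l + 1 + r)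
  · simp [hXab, hab]
  · tauto

/-- Both drawings have to be carried through the induction, because the two sides of a gap are drawn
from opposite ends. -/
theorem drawable (m : ℕ) : ∀ (a : ℤ) (F : Finset (ℤ × ℤ)), Inside F a (a + m) → Orderable F →
    F.card ≤ m ∧ (F.card = m → Drawable F a m) := by
  induction m using Nat.strong_induction_on with
  | _ m ih =>
  intro a F hI hF
  rcases Nat.eq_zero_or_pos m with rfl | hm
  · obtain rfl : F = ∅ := Finset.eq_empty_of_forall_notMem fun X hX => by
      have := hI X hX
      push_cast at this
      omega
    exact ⟨le_rfl, fun _ => ⟨⟨.leaf, rfl, by simp [TernaryTree.arcs]⟩,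
      ⟨.leaf, rfl, by simp [TernaryTree.arcs]⟩⟩⟩
  -- The longest arc may span all of `[a, a + m]`, so induction cannot be used for the arcs up to
  -- its far end, only for the two sides of the gap below it.
  have ihle : ∀ m' ≤ m, ∀ m'' < m', ∀ (a : ℤ) (F : Finset (ℤ × ℤ)), Inside F a (a + m'') →
      Orderable F → F.card ≤ m'' ∧ (F.card = m'' → Drawable F a m'') :=
    fun m' h m'' h' => ih m'' (by omega)
  have right : F.card ≤ m ∧ (F.card = m →
      ∃ T : TernaryTree, T.numNodes = m ∧ ∀ X, X ∈ F ↔ X ∈ T.arcs 1 a) := by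
    by_cases hne : (F.filter fun X => X.1 = a).Nonempty
    swap
    -- With no arc at `a` the set lives on a shorter interval and has fewer than `m` arcs.
    · have := ih (m - 1) (by omega) (a + 1) F (fun X hX => by
        have := hI X hX
        have : X.1 ≠ a := fun h => hne ⟨X, Finset.mem_filter.2 ⟨hX, h⟩⟩
        omega) hF
      exact ⟨by omega, by omega⟩
    obtain ⟨⟨_, r⟩, hr, hmax⟩ := Finset.exists_max_image _ (fun X => X.2) hne
    obtain ⟨hrF, rfl⟩ := Finset.mem_filter.1 hr
    have hr' := hI _ hrF
    simp only at hr' hmax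
    rename_i a
    obtain ⟨l, rfl⟩ : ∃ l : ℕ, r = a + l := ⟨(r - a).toNat, by omega⟩
    obtain ⟨q, rfl⟩ : ∃ q : ℕ, m = l + q := ⟨m - l, by omega⟩
    have hsplit := card_split (F := F) fun X => X.2 ≤ a + l
    have hgap : ∀ X ∈ F, X.2 ≤ a + l ∨ a + l ≤ X.1 := by
      intro X hX
      by_contra! h
      have hXI := hI X hX
      rcases hXI.1.lt_or_eq with h' | h'
      · exact hF.noncrossing hrF hX h' h.2 h.1
      · have := hmax X (Finset.mem_filter.2 ⟨hX, h'.symm⟩)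
        omega
    have h1 := drawable_of_forall_lt (ihle l (by omega)) (a := a)
      (F := F.filter fun X => X.2 ≤ a + l) (fun X hX => by
        obtain ⟨hX, h⟩ := Finset.mem_filter.1 hX
        have := hI X hX
        omega) (hF.mono (Finset.filter_subset _ _)) (Finset.mem_filter.2 ⟨hrF, le_rfl⟩)
    have h2 := ih q (by omega) (a + l) (F.filter fun X => ¬ X.2 ≤ a + l) (fun X hX => by
        obtain ⟨hX, h⟩ := Finset.mem_filter.1 hX
        have := hI X hX
        have := hgap X hX
        push_cast at *
        omega) (hF.mono (Finset.filter_subset _ _))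
    refine ⟨by omega, fun hc => ?_⟩
    obtain ⟨A, B, hAB, hABF⟩ := h1.2 (by omega)
    obtain ⟨⟨C, hC, hCF⟩, -⟩ := h2.2 (by omega)
    refine ⟨.node A B C, by simp only [TernaryTree.numNodes]; omega, fun X => ?_⟩
    have ht : TernaryTree.rootFar A B 1 a = a + l := by
      rw [TernaryTree.rootFar, ← hAB]; push_cast; ring
    rw [TernaryTree.mem_arcs_node, ht, ← hCF,
      show arc (a, a + (l : ℤ)) = (a, a + (l : ℤ)) by simp [arc]]
    have := hABF X
    simp only [Finset.mem_filter] at this ⊢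
    tauto
  refine ⟨right.1, fun hc => ⟨right.2 hc, ?_⟩⟩
  by_cases hne : (F.filter fun X => X.2 = a + m).Nonempty
  swap
  · have := ih (m - 1) (by omega) a F (fun X hX => by
      have := hI X hX
      have : X.2 ≠ a + m := fun h => hne ⟨X, Finset.mem_filter.2 ⟨hX, h⟩⟩
      omega) hF
    omega
  obtain ⟨⟨l, _⟩, hl, hmin⟩ := Finset.exists_min_image _ (fun X => X.1) hne
  obtain ⟨hlF, h⟩ := Finset.mem_filter.1 hl
  obtain rfl := h
  have hl' := hI _ hlF
  simp only at hl' hmin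
  obtain ⟨q, rfl⟩ : ∃ q : ℕ, l = a + q := ⟨(l - a).toNat, by omega⟩
  obtain ⟨r, rfl⟩ : ∃ r : ℕ, m = q + r := ⟨m - q, by omega⟩
  have hb : a + ((q + r : ℕ) : ℤ) = a + q + r := by push_cast; ring
  rw [hb] at hlF hl' hI hmin ⊢
  have hsplit := card_split (F := F) fun X => X.2 ≤ a + q
  have hgap : ∀ X ∈ F, X.2 ≤ a + q ∨ a + q ≤ X.1 := by
    intro X hX
    by_contra! h
    have hXI := hI X hX
    rcases hXI.2.2.lt_or_eq with h' | h'
    · exact hF.noncrossing hX hlF h.2 h.1 h'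
    · have := hmin X (Finset.mem_filter.2 ⟨hX, h'⟩)
      omega
  have h1 := drawable_of_forall_lt (ihle r (by omega)) (a := a + q)
    (F := F.filter fun X => ¬ X.2 ≤ a + q) (fun X hX => by
      obtain ⟨hX, h⟩ := Finset.mem_filter.1 hX
      have := hI X hX
      have := hgap X hX
      omega) (hF.mono (Finset.filter_subset _ _)) (Finset.mem_filter.2 ⟨hlF, by omega⟩)
  have h2 := ih q (by omega) a (F.filter fun X => X.2 ≤ a + q) (fun X hX => by
      obtain ⟨hX, h⟩ := Finset.mem_filter.1 hX
      have := hI X hX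
      omega) (hF.mono (Finset.filter_subset _ _))
  obtain ⟨A, B, hAB, hABF⟩ := h1.2 (by omega)
  obtain ⟨-, C, hC, hCF⟩ := h2.2 (by omega)
  -- Seen from the right end the roles are exchanged: the tree right of the gap is now the one at
  -- the near end.
  refine ⟨.node B A C, by simp only [TernaryTree.numNodes]; omega, fun X => ?_⟩
  have ht : TernaryTree.rootFar B A (-1) (a + q + r) = a + q := by
    rw [TernaryTree.rootFar, ← hAB]; push_cast; ring
  rw [TernaryTree.mem_arcs_node, ht, ← hCF, neg_neg,
    show arc (a + (q : ℤ) + r, a + (q : ℤ)) = (a + (q : ℤ), a + (q : ℤ) + r) by simp [arc]]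
  have := hABF X
  simp only [Finset.mem_filter] at this ⊢
  clear * - this
  tauto

/-! ### Representations, and morphisms into and out of intervals. -/

/-- The number of a vertex, as an object of the path category. -/
def pos {n : ℕ} (v : Paths (Vertex n)) : ℕ := Vertex.val (n := n) v

/-- The vertex with a given number, as an object of the path category. -/
def pt {n : ℕ} (v : ℕ) (h1 : 1 ≤ v) (hn : v ≤ n) : Paths (Vertex n) :=
  Vertex.mk (n := n) v h1 hn

section

variable {k : Type u} [Field k] {n : ℕ}

theorem pos_pt (v : ℕ) (h1 : 1 ≤ v) (hn : v ≤ n) : pos (pt v h1 hn) = v := rfl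

theorem one_le_pos (v : Paths (Vertex n)) : 1 ≤ pos v := Vertex.one_le (n := n) v

theorem pos_le (v : Paths (Vertex n)) : pos v ≤ n := Vertex.le_n (n := n) v

theorem pos_injective {v w : Paths (Vertex n)} (h : pos v = pos w) : v = w :=
  Vertex.ext (n := n) h

theorem pos_of_arrow {v w : Vertex n} (e : v ⟶ w) :
    pos ((Paths.of _).obj v) + 1 = pos ((Paths.of _).obj w) := e.down

theorem pos_le_of_hom {v w : Paths (Vertex n)} (f : v ⟶ w) : pos v ≤ pos w := by
  refine Paths.induction_fixed_source (a := v) (P := fun {b} _ => pos v ≤ pos b) le_rfl ?_ f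
  intro x y p q h
  have := pos_of_arrow q
  omega

theorem nonempty_hom {v w : Paths (Vertex n)} (h : pos v ≤ pos w) : Nonempty (v ⟶ w) := by
  obtain ⟨d, hd⟩ := Nat.exists_eq_add_of_le h
  induction d generalizing w with
  | zero => obtain rfl : v = w := pos_injective (by omega)
            exact ⟨𝟙 _⟩
  | succ d ih =>
    have := one_le_pos v
    have := pos_le w
    obtain ⟨p⟩ := ih (w := pt (pos v + d) (by omega) (by omega)) (by simp [pos_pt]) rfl
    exact ⟨p ≫ (Paths.of (Vertex n)).map (PLift.up hd.symm)⟩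

theorem path_eq {v w : Vertex n} (f g : Quiver.Path v w) : f = g := by
  induction f with
  | nil =>
    cases g with
    | nil => rfl
    | cons p e =>
      have h1 := pos_le_of_hom (n := n) p
      have h2 := pos_of_arrow e
      change pos v ≤ _ at h1
      change _ = pos v at h2
      simp only [Paths.of] at h2
      omega
  | @cons x y p q h =>
    cases g with
    | nil =>
      have h1 := pos_le_of_hom (n := n) p
      have h2 := pos_of_arrow q
      simp only [Paths.of] at h2
      omega
    | @cons z _ p' e =>
      have h1 := pos_of_arrow e
      have h2 := pos_of_arrow q
      obtain rfl : x = z := pos_injective (n := n) (by simp only [Paths.of] at h1 h2; omega)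
      obtain rfl : q = e := show PLift.up q.down = PLift.up e.down from rfl
      rw [h p']

theorem hom_eq {v w : Paths (Vertex n)} (f g : v ⟶ w) : f = g := path_eq f g

/-- The map of a representation along the path from `v` to `w`. -/
noncomputable def trans (V : Rep k n) {v w : Paths (Vertex n)} (h : pos v ≤ pos w) :
    V.obj v ⟶ V.obj w :=
  V.map (nonempty_hom h).some

theorem map_eq_trans (V : Rep k n) {v w : Paths (Vertex n)} (f : v ⟶ w) (h : pos v ≤ pos w) :
    V.map f = trans V h := by
  rw [trans, hom_eq f]

theorem trans_self (V : Rep k n) (v : Paths (Vertex n)) : trans V (le_refl (pos v)) = 𝟙 _ := by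
  rw [← map_eq_trans V (𝟙 v), V.map_id]

theorem trans_comp (V : Rep k n) {v w x : Paths (Vertex n)} (h : pos v ≤ pos w)
    (h' : pos w ≤ pos x) : trans V h ≫ trans V h' = trans V (h.trans h') := by
  rw [trans, trans, ← V.map_comp, map_eq_trans]

theorem trans_trans (V : Rep k n) {v w x : Paths (Vertex n)} (h : pos v ≤ pos w)
    (h' : pos w ≤ pos x) (y : V.obj v) :
    (trans V h').hom ((trans V h).hom y) = (trans V (h.trans h')).hom y := by
  rw [← trans_comp V h h']
  rfl

/-- A morphism of representations, given by its components. -/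
def homMk {V W : Rep k n} (φ : ∀ v, V.obj v ⟶ W.obj v)
    (h : ∀ v w : Paths (Vertex n), ∀ hvw : pos v + 1 = pos w,
      trans V (v := v) (w := w) (by omega) ≫ φ w = φ v ≫ trans W (by omega)) : V ⟶ W where
  app := φ
  naturality {v w} f := by
    refine Paths.induction (V := Vertex n)
      (P := fun {v w} f => V.map f ≫ φ w = φ v ≫ W.map f) ?_ ?_ f
    · intro v
      rw [V.map_id, W.map_id, Category.id_comp, Category.comp_id]
    · intro u v w p q hp
      have hq := pos_of_arrow q
      rw [V.map_comp, W.map_comp, Category.assoc, map_eq_trans V ((Paths.of _).map q) (by omega),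
        h _ _ hq, ← Category.assoc, hp, Category.assoc,
        map_eq_trans W ((Paths.of _).map q) (by omega)]

theorem naturality {V W : Rep k n} (f : V ⟶ W) {v w : Paths (Vertex n)} (h : pos v ≤ pos w) :
    trans V h ≫ f.app w = f.app v ≫ trans W h :=
  f.naturality _

theorem naturality_apply {V W : Rep k n} (f : V ⟶ W) {v w : Paths (Vertex n)}
    (h : pos v ≤ pos w) (x : V.obj v) :
    (f.app w).hom ((trans V h).hom x) = (trans W h).hom ((f.app v).hom x) :=
  congrArg (fun g => g.hom x) (naturality f h)

variable (k)

/-- The identification of the coordinate of `M_{i,j}` at a vertex of its support. -/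
def coord (n i j : ℕ) {v : Paths (Vertex n)} (h : i < pos v ∧ pos v ≤ j) :
    (intervalRep k n i j).obj v →ₗ[k] k :=
  LinearMap.proj (R := k) (φ := fun _ : PLift (i < pos v ∧ pos v ≤ j) => k) (PLift.up h)

variable {k}

theorem coord_ext {i j : ℕ} {v : Paths (Vertex n)} {x y : (intervalRep k n i j).obj v}
    (h : ∀ h : i < pos v ∧ pos v ≤ j, coord k n i j h x = coord k n i j h y) : x = y :=
  funext fun ⟨h'⟩ => h h'

/-- The element of `M_{i,j}` at the vertex `v` with coordinate `c`. -/
def elt (k : Type u) [Field k] (n i j : ℕ) (v : Paths (Vertex n)) (c : k) :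
    (intervalRep k n i j).obj v :=
  fun _ => c

theorem coord_elt {i j : ℕ} {v : Paths (Vertex n)} (h : i < pos v ∧ pos v ≤ j) (c : k) :
    coord k n i j h (elt k n i j v c) = c := rfl

theorem coord_step {i j : ℕ} {v w : Paths (Vertex n)} (hvw : pos v + 1 = pos w)
    (hv : i < pos v ∧ pos v ≤ j) (hw : i < pos w ∧ pos w ≤ j)
    (x : (intervalRep k n i j).obj v) :
    coord k n i j hw ((trans (intervalRep k n i j) (show pos v ≤ pos w by omega)).hom x) =
      coord k n i j hv x := by
  let e : @Quiver.Hom (Vertex n) _ v w := PLift.up hvw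
  have h1 : trans (intervalRep k n i j) (show pos v ≤ pos w by omega) = _ :=
    (map_eq_trans (intervalRep k n i j) ((Paths.of (Vertex n)).map e) _).symm
  rw [h1]
  have h2 := Paths.lift_toPath (V := Vertex n) (C := ModuleCat.{u} k)
    { obj := fun v => ModuleCat.of k (PLift (i < v.val ∧ v.val ≤ j) → k)
      map := fun {v _} _ => ModuleCat.ofHom <| LinearMap.pi fun _ =>
        if h : i < v.val ∧ v.val ≤ j then LinearMap.proj (PLift.up h) else 0 } e
  have h3 := congrArg (fun f => f.hom x (PLift.up hw)) h2
  refine h3.trans ?_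
  change (if h : i < pos v ∧ pos v ≤ j then
    LinearMap.proj (R := k) (φ := fun _ : PLift (i < pos v ∧ pos v ≤ j) => k) (PLift.up h)
      else 0) x = _
  rw [dif_pos hv]
  rfl

end

section

variable {k : Type u} [Field k] {n : ℕ}

theorem coord_trans {i j : ℕ} {v w : Paths (Vertex n)} (hvw : pos v ≤ pos w)
    (hv : i < pos v ∧ pos v ≤ j) (hw : i < pos w ∧ pos w ≤ j)
    (x : (intervalRep k n i j).obj v) :
    coord k n i j hw ((trans (intervalRep k n i j) hvw).hom x) = coord k n i j hv x := by
  obtain ⟨d, hd⟩ := Nat.exists_eq_add_of_le hvw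
  induction d generalizing w with
  | zero =>
    obtain rfl : v = w := pos_injective (by omega)
    rw [trans_self]
    rfl
  | succ d ih =>
    have := one_le_pos v
    have := pos_le w
    let z : Paths (Vertex n) := pt (pos v + d) (by omega) (by omega)
    have hz : pos z = pos v + d := rfl
    rw [← trans_trans (intervalRep k n i j) (w := z) (by omega) (by omega) x,
      coord_step (by omega) (by omega) hw, ih (by omega) (by omega) hz]

theorem eq_zero_of_outside {i j : ℕ} {v : Paths (Vertex n)} (h : ¬ (i < pos v ∧ pos v ≤ j))
    (x : (intervalRep k n i j).obj v) : x = 0 :=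
  coord_ext fun h' => absurd h' h

theorem eq_smul_elt {i j : ℕ} {v : Paths (Vertex n)} (h : i < pos v ∧ pos v ≤ j)
    (x : (intervalRep k n i j).obj v) : x = coord k n i j h x • elt k n i j v 1 :=
  coord_ext fun _ => by rw [map_smul, coord_elt, smul_eq_mul, mul_one]

theorem trans_elt {i j : ℕ} {v w : Paths (Vertex n)} (hvw : pos v ≤ pos w) (hv : i < pos v)
    (c : k) :
    (trans (intervalRep k n i j) hvw).hom (elt k n i j v c) = elt k n i j w c :=
  coord_ext fun hw => by rw [coord_trans hvw ⟨hv, by omega⟩ hw, coord_elt, coord_elt]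

/-- The components of the morphism from `M_{i,j}` given by an element at the vertex `i + 1`. -/
noncomputable def fromIntervalApp (V : Rep k n) {i : ℕ} (j : ℕ) {a : Paths (Vertex n)}
    (ha : pos a = i + 1) (x : V.obj a) (v : Paths (Vertex n)) :
    (intervalRep k n i j).obj v →ₗ[k] V.obj v :=
  if h : i < pos v ∧ pos v ≤ j then
    (coord k n i j h).smulRight ((trans V (v := a) (w := v) (by omega)).hom x) else 0

theorem fromIntervalApp_apply (V : Rep k n) {i j : ℕ} {a : Paths (Vertex n)}
    (ha : pos a = i + 1) (x : V.obj a) {v : Paths (Vertex n)} (h : i < pos v ∧ pos v ≤ j)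
    (m : (intervalRep k n i j).obj v) :
    fromIntervalApp V j ha x v m =
      coord k n i j h m • (trans V (v := a) (w := v) (by omega)).hom x := by
  rw [fromIntervalApp, dif_pos h, LinearMap.smulRight_apply]

/-- The morphism from `M_{i,j}` given by an element at the vertex `i + 1` that becomes zero at the
vertex `j + 1`. -/
noncomputable def fromInterval (V : Rep k n) {i j : ℕ} {a : Paths (Vertex n)}
    (ha : pos a = i + 1) (x : V.obj a)
    (hx : ∀ (w : Paths (Vertex n)) (h : pos a ≤ pos w), j < pos w → (trans V h).hom x = 0) :
    intervalRep k n i j ⟶ V :=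
  homMk (fun v => ModuleCat.ofHom (fromIntervalApp V j ha x v)) (by
    intro v w hvw
    ext m
    change fromIntervalApp V j ha x w ((trans _ _).hom m) =
      (trans V _).hom (fromIntervalApp V j ha x v m)
    by_cases hv : i < pos v ∧ pos v ≤ j
    · rw [fromIntervalApp_apply V ha x hv, map_smul, trans_trans]
      by_cases hw : i < pos w ∧ pos w ≤ j
      · rw [fromIntervalApp_apply V ha x hw, coord_step hvw hv hw]
      · rw [hx w _ (by omega), smul_zero, eq_zero_of_outside hw ((trans _ _).hom m), map_zero]
    · rw [eq_zero_of_outside hv m, map_zero, map_zero, map_zero, map_zero])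

theorem fromInterval_elt (V : Rep k n) {i j : ℕ} (hij : i < j) {a : Paths (Vertex n)}
    (ha : pos a = i + 1) (x : V.obj a)
    (hx : ∀ (w : Paths (Vertex n)) (h : pos a ≤ pos w), j < pos w → (trans V h).hom x = 0) :
    ((fromInterval V ha x hx).app a).hom (elt k n i j a 1) = x := by
  refine (fromIntervalApp_apply V ha x (by omega) _).trans ?_
  rw [coord_elt, trans_self, one_smul]
  rfl

/-- `M_{i,j}` is generated by its element at the vertex `i + 1`. -/
theorem fromInterval_hom_ext {V : Rep k n} {i j : ℕ} {a : Paths (Vertex n)} (ha : pos a = i + 1)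
    {f g : intervalRep k n i j ⟶ V}
    (h : (f.app a).hom (elt k n i j a 1) = (g.app a).hom (elt k n i j a 1)) : f = g := by
  ext v : 2
  ext m
  by_cases hv : i < pos v ∧ pos v ≤ j
  · rw [eq_smul_elt hv m, map_smul, map_smul,
      ← trans_elt (show pos a ≤ pos v by omega) (show i < pos a by omega),
      naturality_apply, naturality_apply, h]
  · rw [eq_zero_of_outside hv m, map_zero, map_zero]

/-- The morphism to `M_{i,j}` given by a linear form at the vertex `j`. -/
noncomputable def toInterval (V : Rep k n) {i j : ℕ} {b : Paths (Vertex n)}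
    (hb : pos b = j) (φ : V.obj b →ₗ[k] k)
    (hφ : ∀ v, pos v ≤ i → Subsingleton (V.obj v)) :
    V ⟶ intervalRep k n i j :=
  homMk (fun v => ModuleCat.ofHom <| LinearMap.pi
      (fun h : PLift (i < pos v ∧ pos v ≤ j) => φ ∘ₗ (trans V (hb.symm ▸ h.down.2)).hom)) (by
    intro v w hvw
    ext m
    refine coord_ext fun hw => ?_
    by_cases hv : i < pos v
    · refine Eq.trans ?_ (coord_step hvw ⟨hv, by omega⟩ hw _).symm
      change φ ((trans V _).hom ((trans V _).hom m)) = φ ((trans V _).hom m)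
      rw [trans_trans]
    · have := hφ v (by omega)
      rw [Subsingleton.elim m 0]
      simp)

theorem coord_toInterval (V : Rep k n) {i j : ℕ} {b : Paths (Vertex n)}
    (hb : pos b = j) (φ : V.obj b →ₗ[k] k) (hφ : ∀ v, pos v ≤ i → Subsingleton (V.obj v))
    {v : Paths (Vertex n)} (hv : i < pos v ∧ pos v ≤ j) (x : V.obj v) :
    coord k n i j hv (((toInterval V hb φ hφ).app v).hom x) =
      φ ((trans V (hb.symm ▸ hv.2)).hom x) := rfl

/-- Take a nonzero `x` at the first vertex of the support and follow it to the last vertex `b` where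
it survives. It spans an interval, and a linear form with value `1` on its image at `b` gives a
retraction. A nonzero idempotent of a division ring is `1`, so this direct summand is all of `V`. -/
theorem IsExceptional.exists_iso_intervalRep {V : Rep k n} (hV : IsExceptional V) :
    ∃ i j, i < j ∧ j ≤ n ∧ Nonempty (V ≅ intervalRep k n i j) := by
  have h0 : ∃ m, ∃ v : Paths (Vertex n), pos v = m ∧ Nontrivial (V.obj v) := by
    by_contra! h
    obtain ⟨f, g, hfg⟩ := hV.nontrivial_end
    refine hfg (NatTrans.ext (funext fun v => ?_))
    have := h _ v rfl
    ext m
    exact Subsingleton.elim _ _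
  classical
  obtain ⟨a, ha, hna⟩ := Nat.find_spec h0
  have hmin : ∀ v : Paths (Vertex n), pos v < pos a → Subsingleton (V.obj v) := by
    intro v hv
    rw [ha] at hv
    exact not_nontrivial_iff_subsingleton.1 fun h => Nat.find_min h0 hv ⟨v, rfl, h⟩
  obtain ⟨x, hx⟩ := exists_ne (0 : V.obj a)
  let P : ℕ → Prop := fun m => ∃ b : Paths (Vertex n), pos b = m ∧
    ∃ h : pos a ≤ pos b, (trans V h).hom x ≠ 0
  have hPa : P (pos a) := ⟨a, rfl, le_rfl, by rw [trans_self]; exact hx⟩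
  have hj := Nat.findGreatest_spec (P := P) (pos_le a) hPa
  obtain ⟨b, hb, hab, hxb⟩ := hj
  have hmax : ∀ (w : Paths (Vertex n)) (h : pos a ≤ pos w), pos b < pos w →
      (trans V h).hom x = 0 := by
    intro w h hbw
    by_contra hne
    have := Nat.le_findGreatest (P := P) (pos_le w) ⟨w, rfl, h, hne⟩
    omega
  obtain ⟨i, hi⟩ : ∃ i, pos a = i + 1 := ⟨pos a - 1, by have := one_le_pos a; omega⟩
  obtain ⟨φ, hφ⟩ := Module.Projective.exists_dual_eq_one k hxb
  let f := fromInterval V (j := pos b) hi x hmax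
  let g := toInterval V (i := i) (j := pos b) rfl φ (fun v hv => hmin v (by omega))
  have hfg : f ≫ g = 𝟙 _ := by
    refine fromInterval_hom_ext hi (coord_ext fun h => ?_)
    change coord k n i _ h ((g.app a).hom ((f.app a).hom (elt k n i _ a 1))) = 1
    rw [fromInterval_elt V (by omega), coord_toInterval, hφ]
  let e : End V := g ≫ f
  have hgf : IsUnit e := by
    refine hV.isUnit_end _ fun h => hx ?_
    have h1 : f = 0 := by
      rw [← Category.id_comp f, ← hfg, Category.assoc, show g ≫ f = 0 from h]
      exact Limits.comp_zero
    rw [← fromInterval_elt V (j := pos b) (by omega) hi x hmax]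
    change (f.app a).hom _ = 0
    rw [h1]
    rfl
  have hgf1 : g ≫ f = 𝟙 V := by
    have : e * e = e := by
      change (g ≫ f) ≫ g ≫ f = g ≫ f
      rw [Category.assoc, ← Category.assoc f, hfg, Category.id_comp]
    exact hgf.mul_left_cancel (this.trans (mul_one _).symm)
  exact ⟨i, pos b, by omega, pos_le b, ⟨⟨g, f, hgf1, hfg⟩⟩⟩

end

/-! ### Hom and Ext between intervals. -/

section

variable {k : Type u} [Field k] {n : ℕ}

theorem subsingleton_hom_intervalRep {i j p q : ℕ} (hij : i < j) (hj : j ≤ n) (hq : q ≤ n)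
    (h : ¬ (p ≤ i ∧ i < q ∧ q ≤ j)) :
    Subsingleton (intervalRep k n i j ⟶ intervalRep k n p q) := by
  let a : Paths (Vertex n) := pt (i + 1) (by omega) (by omega)
  have ha : pos a = i + 1 := rfl
  refine subsingleton_of_forall_eq 0 fun f => fromInterval_hom_ext ha (coord_ext fun hp => ?_)
  let b : Paths (Vertex n) := pt (j + 1) (by omega) (by omega)
  have hb : pos b = j + 1 := rfl
  rw [← coord_trans (show pos a ≤ pos b by omega) hp (show p < pos b ∧ pos b ≤ q by omega),
    ← naturality_apply, eq_zero_of_outside (by omega) ((trans (intervalRep k n i j) _).hom _),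
    map_zero, map_zero]
  exact (map_zero _).symm

theorem not_subsingleton_hom_intervalRep {i j p q : ℕ} (hij : i < j) (hj : j ≤ n)
    (h : p ≤ i ∧ i < q ∧ q ≤ j) :
    ¬ Subsingleton (intervalRep k n i j ⟶ intervalRep k n p q) := by
  let a : Paths (Vertex n) := pt (i + 1) (by omega) (by omega)
  have ha : pos a = i + 1 := rfl
  intro hs
  have h1 := fromInterval_elt (intervalRep k n p q) hij ha (elt k n p q a 1)
    (fun w hw hjw => eq_zero_of_outside (by omega) _)
  rw [Subsingleton.elim (fromInterval _ _ _ _) 0] at h1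
  have h2 := congrArg (coord k n p q (v := a) (by omega)) h1
  rw [coord_elt] at h2
  exact zero_ne_one ((map_zero (coord k n p q (v := a) (by omega))).symm.trans h2)

/-- The generator of `M_{i,n}` satisfies no relation, so any lift of its image defines a lift of the
morphism. -/
instance projective_intervalRep (i : ℕ) : Projective (intervalRep k n i n) where
  factors {E X} f e he := by
    by_cases hin : i < n
    · let a : Paths (Vertex n) := pt (i + 1) (by omega) (by omega)
      have ha : pos a = i + 1 := rfl
      have hea : Epi (e.app a) := inferInstance
      obtain ⟨y, hy⟩ := (ModuleCat.epi_iff_surjective _).1 hea ((f.app a).hom (elt k n i n a 1))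
      refine ⟨fromInterval E ha y fun w _ hw => absurd (pos_le w) (by omega),
        fromInterval_hom_ext ha ?_⟩
      refine Eq.trans ?_ hy
      change (e.app a).hom (((fromInterval E ha y _).app a).hom _) = _
      rw [fromInterval_elt E hin]
    · refine ⟨0, NatTrans.ext (funext fun v => ?_)⟩
      ext m
      have := pos_le v
      rw [eq_zero_of_outside (by omega) m, map_zero, map_zero]

theorem app_fromInterval {V : Rep k n} {i j : ℕ} {a : Paths (Vertex n)}
    (ha : pos a = i + 1) (x : V.obj a)
    (hx : ∀ (w : Paths (Vertex n)) (h : pos a ≤ pos w), j < pos w → (trans V h).hom x = 0)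
    {v : Paths (Vertex n)} (h : i < pos v ∧ pos v ≤ j) (m : (intervalRep k n i j).obj v) :
    ((fromInterval V ha x hx).app v).hom m =
      coord k n i j h m • (trans V (v := a) (w := v) (by omega)).hom x :=
  fromIntervalApp_apply V ha x h m

section

variable (k n)

/-- The inclusion of `M_{j,n}` into `M_{i,n}`. -/
noncomputable def intervalIncl (i : ℕ) {j : ℕ} (hn : j < n) :
    intervalRep k n j n ⟶ intervalRep k n i n :=
  fromInterval _ (a := pt (j + 1) (by omega) hn) (pos_pt _ _ _) (elt k n i n _ 1)
    fun w _ hw => absurd (pos_le w) (by omega)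

/-- The projection of `M_{i,n}` onto `M_{i,j}`. -/
noncomputable def intervalProj {i j : ℕ} (hij : i < j) (hn : j < n) :
    intervalRep k n i n ⟶ intervalRep k n i j :=
  fromInterval _ (a := pt (i + 1) (by omega) (by omega)) (pos_pt _ _ _) (elt k n i j _ 1)
    fun w _ hw => absurd (pos_le w) (by omega)

end

theorem app_intervalIncl {i j : ℕ} (hij : i < j) (hn : j < n) {v : Paths (Vertex n)}
    (h : j < pos v ∧ pos v ≤ n) (m : (intervalRep k n j n).obj v) :
    ((intervalIncl k n i hn).app v).hom m = coord k n j n h m • elt k n i n v 1 := by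
  rw [intervalIncl, app_fromInterval _ _ _ h, trans_elt _ (by rw [pos_pt]; omega)]

theorem app_intervalProj {i j : ℕ} (hij : i < j) (hn : j < n) {v : Paths (Vertex n)}
    (h : i < pos v ∧ pos v ≤ n) (m : (intervalRep k n i n).obj v) :
    ((intervalProj k n hij hn).app v).hom m = coord k n i n h m • elt k n i j v 1 := by
  rw [intervalProj, app_fromInterval _ _ _ h, trans_elt _ (by rw [pos_pt]; omega)]

theorem intervalIncl_comp_intervalProj {i j : ℕ} (hij : i < j) (hn : j < n) :
    intervalIncl k n i hn ≫ intervalProj k n hij hn = 0 :=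
  fromInterval_hom_ext (a := pt (j + 1) (by omega) hn) (pos_pt _ _ _)
    ((eq_zero_of_outside (by rw [pos_pt]; omega) _).trans
      (eq_zero_of_outside (by rw [pos_pt]; omega) _).symm)

/-- The projective resolution of `M_{i,j}`. -/
noncomputable abbrev intervalComplex (k : Type u) [Field k] (n : ℕ) {i j : ℕ} (hij : i < j)
    (hn : j < n) : ShortComplex (Rep k n) :=
  ShortComplex.mk _ _ (intervalIncl_comp_intervalProj (k := k) hij hn)

theorem shortExact_intervalComplex {i j : ℕ} (hij : i < j) (hn : j < n) :
    (intervalComplex k n hij hn).ShortExact := by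
  have hepi : Epi (intervalProj k n hij hn) := by
    rw [NatTrans.epi_iff_epi_app]
    intro v
    rw [ModuleCat.epi_iff_surjective]
    intro m
    by_cases hv : i < pos v ∧ pos v ≤ j
    · refine ⟨elt k n i n v (coord k n i j hv m), ?_⟩
      refine (app_intervalProj hij hn ⟨hv.1, pos_le v⟩ _).trans ?_
      rw [coord_elt, ← eq_smul_elt]
    · exact ⟨0, (map_zero _).trans (eq_zero_of_outside hv m).symm⟩
  have hmono : Mono (intervalIncl k n i hn) := by
    rw [NatTrans.mono_iff_mono_app]
    intro v
    rw [ModuleCat.mono_iff_injective]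
    refine (injective_iff_map_eq_zero _).2 fun m hm => coord_ext fun hv => ?_
    have h1 := (app_intervalIncl hij hn hv m).symm.trans hm
    have h2 := congrArg (coord k n i n (v := v) (by omega)) h1
    rw [map_smul, coord_elt, smul_eq_mul, mul_one] at h2
    rw [h2, map_zero, map_zero]
  have hexact : (intervalComplex k n hij hn).Exact := by
    refine ShortComplex.exact_of_g_is_cokernel _
      (Limits.CokernelCofork.IsColimit.ofπ' _ _ fun {Z} f hf => ?_)
    let a : Paths (Vertex n) := pt (i + 1) (by omega) (by omega)
    let b : Paths (Vertex n) := pt (j + 1) (by omega) hn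
    have ha : pos a = i + 1 := rfl
    have hb : pos b = j + 1 := rfl
    -- The generator of `M_{j,n}` becomes the element of `M_{i,n}` at `j + 1`. As `f` kills it, the
    -- image of the generator of `M_{i,n}` vanishes from `j + 1` on and defines a morphism out of
    -- `M_{i,j}`.
    have hfb : (f.app b).hom (elt k n i n b 1) = 0 := by
      have h1 : (f.app b).hom (((intervalIncl k n i hn).app b).hom (elt k n j n b 1)) = 0 :=
        congrArg (fun g : intervalRep k n j n ⟶ Z => (g.app b).hom (elt k n j n b 1)) hf
      rwa [app_intervalIncl hij hn (by omega), coord_elt, one_smul] at h1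
    refine ⟨fromInterval Z ha ((f.app a).hom (elt k n i n a 1)) fun w hw hjw => ?_,
      fromInterval_hom_ext ha ?_⟩
    · rw [← trans_trans Z (w := b) (by omega) (by omega), ← naturality_apply,
        trans_elt _ (by omega), hfb, map_zero]
    · change ((fromInterval Z ha _ _).app a).hom
        (((intervalProj k n hij hn).app a).hom (elt k n i n a 1)) = _
      rw [app_intervalProj hij hn (by omega), coord_elt, one_smul, fromInterval_elt Z hij]
  exact { exact := hexact, mono_f := hmono, epi_g := hepi }

theorem subsingleton_ext_projective {P V : Rep k n} [Projective P] (m : ℕ) :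
    Subsingleton (Abelian.Ext.{u + 1} P V (m + 1)) :=
  Abelian.Ext.subsingleton_of_projective _ _ _

theorem subsingleton_ext_add_two {i j : ℕ} (hij : i < j) (hj : j ≤ n) (V : Rep k n) (m : ℕ) :
    Subsingleton (Abelian.Ext.{u + 1} (intervalRep k n i j) V (m + 2)) := by
  rcases hj.lt_or_eq with hn | rfl
  · refine subsingleton_of_forall_eq 0 fun x => ?_
    have h2 := subsingleton_ext_projective (P := intervalRep k n i n) (V := V) (m + 1)
    have h1 := subsingleton_ext_projective (P := intervalRep k n j n) (V := V) m
    obtain ⟨y, rfl⟩ := Abelian.Ext.contravariant_sequence_exact₃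
      (shortExact_intervalComplex (k := k) hij hn) V x (h2.elim _ _) (n₀ := m + 1) (by omega)
    rw [h1.elim y 0, Abelian.Ext.comp_zero]
  · exact subsingleton_ext_projective _

/-- `Ext^1(M_{i,j}, V)` is the cokernel of `Hom(M_{i,n}, V) → Hom(M_{j,n}, V)`, since `M_{i,n}` is
projective. -/
theorem subsingleton_ext_one_iff {i j : ℕ} (hij : i < j) (hn : j < n) (V : Rep k n) :
    Subsingleton (Abelian.Ext.{u + 1} (intervalRep k n i j) V 1) ↔
      ∀ f : intervalRep k n j n ⟶ V, ∃ g, intervalIncl k n i hn ≫ g = f := by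
  have hS := shortExact_intervalComplex (k := k) hij hn
  constructor
  · intro h f
    obtain ⟨y, hy⟩ := Abelian.Ext.contravariant_sequence_exact₁ hS V (Abelian.Ext.mk₀ f)
      (n₁ := 1) rfl (h.elim _ _)
    obtain ⟨g, rfl⟩ := (Abelian.Ext.mk₀_bijective _ _).2 y
    rw [Abelian.Ext.mk₀_comp_mk₀] at hy
    exact ⟨g, (Abelian.Ext.mk₀_bijective _ _).1 hy⟩
  · intro h
    refine subsingleton_of_forall_eq 0 fun x => ?_
    have h2 := subsingleton_ext_projective (P := intervalRep k n i n) (V := V) 0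
    obtain ⟨y, rfl⟩ := Abelian.Ext.contravariant_sequence_exact₃ hS V x (h2.elim _ _)
      (n₀ := 0) rfl
    obtain ⟨f, rfl⟩ := (Abelian.Ext.mk₀_bijective _ _).2 y
    obtain ⟨g, rfl⟩ := h f
    rw [← Abelian.Ext.mk₀_comp_mk₀]
    exact hS.extClass_comp_assoc _

theorem subsingleton_ext_intervalRep {i j p q : ℕ} (hij : i < j) (hj : j ≤ n)
    (h : ¬ (i < p ∧ p ≤ j ∧ j < q)) :
    Subsingleton (Abelian.Ext.{u + 1} (intervalRep k n i j) (intervalRep k n p q) 1) := by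
  rcases hj.lt_or_eq with hn | rfl
  swap
  · exact subsingleton_ext_projective _
  rw [subsingleton_ext_one_iff hij hn]
  intro f
  let a : Paths (Vertex n) := pt (i + 1) (by omega) (by omega)
  let b : Paths (Vertex n) := pt (j + 1) (by omega) hn
  have ha : pos a = i + 1 := rfl
  have hb : pos b = j + 1 := rfl
  by_cases hp : p < pos b ∧ pos b ≤ q
  · refine ⟨fromInterval _ ha (elt k n p q a (coord k n p q hp ((f.app b).hom (elt k n j n b 1))))
      fun w _ hw => absurd (pos_le w) (by omega), fromInterval_hom_ext hb (coord_ext fun _ => ?_)⟩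
    change coord k n p q hp (((fromInterval _ ha _ _).app b).hom
      (((intervalIncl k n i hn).app b).hom (elt k n j n b 1))) = _
    rw [app_intervalIncl hij hn (by omega), coord_elt, one_smul,
      app_fromInterval ha _ _ (by omega), coord_elt, one_smul, trans_elt _ (by omega), coord_elt]
  · exact ⟨0, fromInterval_hom_ext hb (coord_ext fun h => absurd h hp)⟩

theorem not_subsingleton_ext_intervalRep {i j p q : ℕ} (hij : i < j) (hq : q ≤ n)
    (h : i < p ∧ p ≤ j ∧ j < q) :
    ¬ Subsingleton (Abelian.Ext.{u + 1} (intervalRep k n i j) (intervalRep k n p q) 1) := by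
  have hn : j < n := by omega
  rw [subsingleton_ext_one_iff hij hn]
  intro hs
  let a : Paths (Vertex n) := pt (i + 1) (by omega) (by omega)
  let b : Paths (Vertex n) := pt (j + 1) (by omega) hn
  have ha : pos a = i + 1 := rfl
  have hb : pos b = j + 1 := rfl
  obtain ⟨g, hg⟩ := hs (fromInterval _ hb (elt k n p q b 1)
    fun w _ hw => absurd (pos_le w) (by omega))
  -- Because `i < p`, the target vanishes at `i + 1`, where `M_{i,n}` is generated.
  obtain rfl : g = 0 := fromInterval_hom_ext ha (coord_ext fun h => by omega)
  rw [Limits.comp_zero] at hg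
  have h1 := fromInterval_elt (intervalRep k n p q) (j := n) hn hb (elt k n p q b 1)
    fun w _ hw => absurd (pos_le w) (by omega)
  rw [← hg] at h1
  have h2 := congrArg (coord k n p q (v := b) (by omega)) h1
  rw [coord_elt] at h2
  exact zero_ne_one ((map_zero (coord k n p q (v := b) (by omega))).symm.trans h2)

theorem isExceptional_intervalRep {i j : ℕ} (hij : i < j) (hj : j ≤ n) :
    IsExceptional (intervalRep k n i j) := by
  let a : Paths (Vertex n) := pt (i + 1) (by omega) (by omega)
  have ha : pos a = i + 1 := rfl
  have haj : i < pos a ∧ pos a ≤ j := by omega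
  have hne : elt k n i j a 1 ≠ 0 := fun h =>
    one_ne_zero ((congrArg (coord k n i j haj) h).trans (map_zero _))
  refine ⟨fun v => ?_, ⟨𝟙 _, 0, fun h => hne ?_⟩, fun f hf => ?_, fun m hm => ?_⟩
  · change Module.Finite k (PLift (i < pos v ∧ pos v ≤ j) → k)
    infer_instance
  · exact congrArg (fun f : intervalRep k n i j ⟶ intervalRep k n i j =>
      (f.app a).hom (elt k n i j a 1)) h
  · let F : intervalRep k n i j ⟶ intervalRep k n i j := f
    let c := coord k n i j haj ((F.app a).hom (elt k n i j a 1))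
    have hFc : (F.app a).hom (elt k n i j a 1) = elt k n i j a c := coord_ext fun _ => rfl
    have hc : c ≠ 0 := fun hc => hf <| fromInterval_hom_ext ha <|
      coord_ext fun _ => hc.trans (map_zero _).symm
    have hx : ∀ (w : Paths (Vertex n)) (h : pos a ≤ pos w), j < pos w →
        (trans (intervalRep k n i j) h).hom (elt k n i j a c⁻¹) = 0 :=
      fun w _ hw => eq_zero_of_outside (by omega) _
    let G := fromInterval (intervalRep k n i j) ha (elt k n i j a c⁻¹) hx
    have hG : ∀ m, (G.app a).hom m = coord k n i j haj m • elt k n i j a c⁻¹ := fun m => by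
      rw [app_fromInterval ha _ hx haj, trans_elt _ (by omega)]
    have hFG : F ≫ G = 𝟙 _ := by
      refine fromInterval_hom_ext ha (coord_ext fun _ => ?_)
      change coord k n i j haj ((G.app a).hom ((F.app a).hom (elt k n i j a 1))) = 1
      rw [hFc, hG, coord_elt, map_smul, coord_elt, smul_eq_mul, mul_inv_cancel₀ hc]
    have hGF : G ≫ F = 𝟙 _ := by
      refine fromInterval_hom_ext ha (coord_ext fun _ => ?_)
      change coord k n i j haj ((F.app a).hom ((G.app a).hom (elt k n i j a 1))) = 1
      rw [hG, coord_elt, one_smul, eq_smul_elt haj (elt k n i j a c⁻¹), coord_elt, map_smul, hFc,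
        map_smul, coord_elt, smul_eq_mul, inv_mul_cancel₀ hc]
    exact ⟨⟨f, G, hGF, hFG⟩, rfl⟩
  · obtain rfl | ⟨m, rfl⟩ : m = 1 ∨ ∃ l, m = l + 2 := by
      rcases m with _ | _ | m
      · omega
      · exact .inl rfl
      · exact .inr ⟨m, rfl⟩
    · exact subsingleton_ext_intervalRep hij hj (by omega)
    · exact subsingleton_ext_add_two hij hj _ m

theorem eq_of_iso_intervalRep {i j p q : ℕ} (hij : i < j) (hj : j ≤ n) (hpq : p < q) (hq : q ≤ n)
    (e : intervalRep k n i j ≅ intervalRep k n p q) : i = p ∧ j = q := by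
  have key : ∀ {i j p q : ℕ}, i < j → j ≤ n → p < q → q ≤ n →
      (intervalRep k n i j ≅ intervalRep k n p q) → p ≤ i ∧ i < q ∧ q ≤ j := by
    intro i j p q hij hj hpq hq e
    by_contra h
    have := subsingleton_hom_intervalRep (k := k) hij hj hq h
    refine not_subsingleton_hom_intervalRep (k := k) (n := n) (i := i) (j := j) (p := i) (q := j)
      hij hj (by omega) ⟨fun f g => ?_⟩
    rw [← cancel_mono e.hom]
    exact Subsingleton.elim _ _
  have h1 := key hij hj hpq hq e
  have h2 := key hpq hq hij hj e.symm
  omega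

theorem subsingleton_hom_of_iso {V V' W W' : Rep k n} (e : V ≅ V') (e' : W ≅ W')
    (h : Subsingleton (V ⟶ W)) : Subsingleton (V' ⟶ W') :=
  (Iso.homCongr e e').symm.subsingleton

theorem subsingleton_ext_of_iso {V V' W W' : Rep k n} (e : V ≅ V') (e' : W ≅ W') {m : ℕ}
    (h : Subsingleton (Abelian.Ext.{u + 1} V W m)) :
    Subsingleton (Abelian.Ext.{u + 1} V' W' m) := by
  refine subsingleton_of_forall_eq 0 fun x => ?_
  have h1 : (Abelian.Ext.mk₀ e.hom).comp (x.comp (Abelian.Ext.mk₀ e'.inv) (add_zero m))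
    (zero_add m) = 0 := h.elim _ _
  have h2 := congrArg (fun y => (Abelian.Ext.mk₀ e.inv).comp
    (y.comp (Abelian.Ext.mk₀ e'.hom) (add_zero m)) (zero_add m)) h1
  simpa using h2

end

/-! ### Distances in rooted graphs, and uniqueness of tree and labelling. -/

/-- Following parents gives a walk of length `d v` from the root, and no walk is shorter because `d`
grows by at most `1` per edge. -/
theorem dist_eq_of_parent {V : Type*} {G : SimpleGraph V} {r : V} {d : V → ℕ} (h0 : d r = 0)
    (hadj : ∀ u v, G.Adj u v → d v ≤ d u + 1)
    (hpar : ∀ v, v ≠ r → ∃ u, G.Adj u v ∧ d v = d u + 1) (v : V) : G.dist r v = d v := by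
  have hwalk : ∀ m v, d v = m → ∃ p : G.Walk r v, p.length = m := by
    intro m
    induction m with
    | zero =>
      intro v hv
      obtain rfl : v = r := by
        by_contra h
        obtain ⟨u, -, hu⟩ := hpar v h
        omega
      exact ⟨.nil, rfl⟩
    | succ m ih =>
      intro v hv
      obtain ⟨u, huv, hu⟩ := hpar v (by rintro rfl; omega)
      obtain ⟨p, hp⟩ := ih u (by omega)
      exact ⟨p.concat huv, by rw [SimpleGraph.Walk.length_concat, hp]⟩
  have hle : ∀ {a b : V} (p : G.Walk a b), d b ≤ d a + p.length := by
    intro a b p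
    induction p with
    | nil => simp
    | cons h p ih =>
      have := hadj _ _ h
      rw [SimpleGraph.Walk.length_cons]
      omega
  obtain ⟨p, hp⟩ := hwalk _ v rfl
  obtain ⟨q, hq⟩ := p.reachable.exists_walk_length_eq_dist
  have h1 := SimpleGraph.dist_le p
  have h2 := hle q
  omega

namespace TernaryTree

theorem IsNode.of_append {T : TernaryTree} {w w' : List Letter} (h : T.IsNode (w ++ w')) :
    T.IsNode w := by
  induction T generalizing w with
  | leaf => exact h.elim
  | node A B C hA hB hC =>
    rcases w with _ | ⟨_ | _ | _, w⟩
    · trivial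
    · exact hA h
    · exact hB h
    · exact hC h

theorem eq_of_isNode_iff {T T' : TernaryTree} (h : ∀ w, T.IsNode w ↔ T'.IsNode w) : T = T' := by
  induction T generalizing T' with
  | leaf =>
    cases T' with
    | leaf => rfl
    | node => exact ((h []).2 trivial).elim
  | node A B C hA hB hC =>
    cases T' with
    | leaf => exact ((h []).1 trivial).elim
    | node A' B' C' =>
      rw [hA fun w => h (.a :: w), hB fun w => h (.b :: w), hC fun w => h (.c :: w)]

end TernaryTree

section

variable {k : Type u} [Field k] {n : ℕ}

theorem M_injective {i j p q : Fin (n + 1)} (hij : i < j) (hpq : p < q)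
    (h : M k i j = M k p q) : i = p ∧ j = q := by
  obtain ⟨e⟩ := Quotient.exact h
  have := eq_of_iso_intervalRep (k := k) (n := n) hij (by omega) hpq (by omega) e
  exact ⟨Fin.ext this.1, Fin.ext this.2⟩

theorem leftChild_unique {S : Set (IsoClass k n)} {i j p q p' q' : Fin (n + 1)} {d : Letter}
    (h : LeftChild S i j d p q) (h' : LeftChild S i j d p' q') : p = p' ∧ q = q' := by
  cases d
  · exact ⟨h.2.unique h'.2, h.1.trans h'.1.symm⟩
  · exact ⟨h.1.trans h'.1.symm, h.2.unique h'.2⟩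
  · exact ⟨h.2.unique h'.2, h.1.trans h'.1.symm⟩

theorem rightChild_unique {S : Set (IsoClass k n)} {i j p q p' q' : Fin (n + 1)} {d : Letter}
    (h : RightChild S i j d p q) (h' : RightChild S i j d p' q') : p = p' ∧ q = q' := by
  cases d
  · exact ⟨h.1.trans h'.1.symm, h.2.unique h'.2⟩
  · exact ⟨h.2.unique h'.2, h.1.trans h'.1.symm⟩
  · exact ⟨h.1.trans h'.1.symm, h.2.unique h'.2⟩

theorem isChild_unique {S : Set (IsoClass k n)} {d : Letter} {X Y Y' : IsoClass k n}
    (h : IsChild S d X Y) (h' : IsChild S d X Y') : Y = Y' := by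
  obtain ⟨i, j, p, q, hij, rfl, rfl, h⟩ := h
  obtain ⟨i', j', p', q', hij', hX, rfl, h'⟩ := h'
  obtain ⟨rfl, rfl⟩ := M_injective hij.1 hij'.1 hX
  rcases h with ⟨ho, h⟩ | ⟨ho, h⟩ <;> rcases h' with ⟨ho', h'⟩ | ⟨ho', h'⟩
  · obtain ⟨rfl, rfl⟩ := leftChild_unique h h'
    rfl
  · exact (lt_asymm ho ho').elim
  · exact (lt_asymm ho ho').elim
  · obtain ⟨rfl, rfl⟩ := rightChild_unique h h'
    rfl

theorem isRoot_unique {S : Set (IsoClass k n)} {X X' : IsoClass k n} (h : IsRoot S X)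
    (h' : IsRoot S X') : X = X' := by
  obtain ⟨r, hr, rfl⟩ := h
  obtain ⟨r', hr', rfl⟩ := h'
  rw [hr.unique hr']

theorem IsChildrenLabelling.isNode_and_eq {S : Set (IsoClass k n)} {T T' : TernaryTree}
    {ℓ : T.Node ≃ S} {ℓ' : T'.Node ≃ S} (h : IsChildrenLabelling S T ℓ)
    (h' : IsChildrenLabelling S T' ℓ') (w : List Letter) (hw : T.IsNode w) :
    ∃ hw' : T'.IsNode w, ℓ' ⟨w, hw'⟩ = ℓ ⟨w, hw⟩ := by
  induction w using List.reverseRecOn with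
  | nil =>
    -- The root of `T` makes `S` nonempty, so `T'` has a node and hence a root.
    have h0 : T'.IsNode [] := (ℓ'.symm (ℓ ⟨[], hw⟩)).2.of_append (w := [])
    exact ⟨h0, Subtype.ext (isRoot_unique (h'.root h0) (h.root hw))⟩
  | append_singleton w d ih =>
    obtain ⟨hw', he⟩ := ih hw.of_append
    have h1 := (h.child ⟨w, hw.of_append⟩ d (ℓ ⟨w ++ [d], hw⟩)).2 ⟨hw, rfl⟩
    rw [← he] at h1
    exact (h'.child ⟨w, hw'⟩ d _).1 h1

theorem IsChildrenLabelling.tree_eq {S : Set (IsoClass k n)} {T T' : TernaryTree}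
    {ℓ : T.Node ≃ S} {ℓ' : T'.Node ≃ S} (h : IsChildrenLabelling S T ℓ)
    (h' : IsChildrenLabelling S T' ℓ') : T = T' :=
  TernaryTree.eq_of_isNode_iff fun w =>
    ⟨fun hw => (h.isNode_and_eq h' w hw).1, fun hw => (h'.isNode_and_eq h w hw).1⟩

theorem IsChildrenLabelling.unique {S : Set (IsoClass k n)} {T : TernaryTree}
    {ℓ ℓ' : T.Node ≃ S} (h : IsChildrenLabelling S T ℓ) (h' : IsChildrenLabelling S T ℓ') :
    ℓ = ℓ' :=
  Equiv.ext fun w => (h.isNode_and_eq h' w.1 w.2).2.symm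

/-! ### From candidates to the children of strands. -/

/-- `R` is the relation of being joined by a strand of `S`. -/
def IsStrandRel (S : Set (IsoClass k n)) (R : ℤ → ℤ → Prop) : Prop :=
  (∀ p q, R p q → R q p) ∧ (∀ p q, R p q → 0 ≤ q ∧ q ≤ n) ∧
    ∀ i j : Fin (n + 1), Strand S i j ↔ i < j ∧ R i j

theorem rightChild_of_better {S : Set (IsoClass k n)} {R : ℤ → ℤ → Prop} (hR : IsStrandRel S R)
    {i j p q : Fin (n + 1)} (hij : i < j) {d : Letter} {x : ℤ} (hx : Candidate R 1 i j d x)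
    (hbest : ∀ y, Candidate R 1 i j d y → Better 1 x y d)
    (hpq : ((p : ℤ), (q : ℤ)) = arc (childNear i j d, x)) : RightChild S i j d p q := by
  obtain ⟨hsymm, -, hS⟩ := hR
  simp only [arc, Prod.mk.injEq] at hpq
  cases d <;> simp only [Candidate, childNear, Better] at hx hbest hpq
  · obtain rfl : p = i := by omega
    obtain rfl : x = q := by omega
    refine ⟨rfl, ⟨by omega, by omega, (hS _ _).2 ⟨by omega, hx.2.2⟩⟩, fun y hy => ?_⟩
    have := hbest y ⟨by have := hy.1; omega, by have := hy.2.1; omega, ((hS _ _).1 hy.2.2).2⟩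
    omega
  · obtain rfl : q = j := by omega
    obtain rfl : x = p := by omega
    refine ⟨rfl, ⟨by omega, by omega, (hS _ _).2 ⟨by omega, hsymm _ _ hx.2.2⟩⟩, fun y hy => ?_⟩
    have := hbest y ⟨by have := hy.1; omega, by have := hy.2.1; omega,
      hsymm _ _ ((hS _ _).1 hy.2.2).2⟩
    omega
  · obtain rfl : p = j := by omega
    obtain rfl : x = q := by omega
    refine ⟨rfl, ⟨by omega, (hS _ _).2 ⟨by omega, hx.2⟩⟩, fun y hy => ?_⟩
    have := hbest y ⟨by have := hy.1; omega, ((hS _ _).1 hy.2).2⟩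
    omega

theorem leftChild_of_better {S : Set (IsoClass k n)} {R : ℤ → ℤ → Prop} (hR : IsStrandRel S R)
    {i j p q : Fin (n + 1)} (hij : i < j) {d : Letter} {x : ℤ} (hx : Candidate R (-1) j i d x)
    (hbest : ∀ y, Candidate R (-1) j i d y → Better (-1) x y d)
    (hpq : ((p : ℤ), (q : ℤ)) = arc (childNear j i d, x)) : LeftChild S i j d p q := by
  obtain ⟨hsymm, -, hS⟩ := hR
  simp only [arc, Prod.mk.injEq] at hpq
  cases d <;> simp only [Candidate, childNear, Better] at hx hbest hpq
  · obtain rfl : q = j := by omega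
    obtain rfl : x = p := by omega
    refine ⟨rfl, ⟨by omega, by omega, (hS _ _).2 ⟨by omega, hsymm _ _ hx.2.2⟩⟩, fun y hy => ?_⟩
    have := hbest y ⟨by have := hy.2.1; omega, by have := hy.1; omega,
      hsymm _ _ ((hS _ _).1 hy.2.2).2⟩
    omega
  · obtain rfl : p = i := by omega
    obtain rfl : x = q := by omega
    refine ⟨rfl, ⟨by omega, by omega, (hS _ _).2 ⟨by omega, hx.2.2⟩⟩, fun y hy => ?_⟩
    have := hbest y ⟨by have := hy.2.1; omega, by have := hy.1; omega, ((hS _ _).1 hy.2.2).2⟩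
    omega
  · obtain rfl : q = i := by omega
    obtain rfl : x = p := by omega
    refine ⟨rfl, ⟨by omega, (hS _ _).2 ⟨by omega, hsymm _ _ hx.2⟩⟩, fun y hy => ?_⟩
    have := hbest y ⟨by have := hy.1; omega, hsymm _ _ ((hS _ _).1 hy.2).2⟩
    omega

theorem exists_candidate_of_rightChild {S : Set (IsoClass k n)} {R : ℤ → ℤ → Prop}
    (hR : IsStrandRel S R) {i j p q : Fin (n + 1)} {d : Letter} (h : RightChild S i j d p q) :
    ∃ x, Candidate R 1 i j d x := by
  obtain ⟨hsymm, -, hS⟩ := hR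
  cases d
  · obtain ⟨-, ⟨h1, h2, h3⟩, -⟩ := h
    exact ⟨q, by omega, by omega, ((hS _ _).1 h3).2⟩
  · obtain ⟨-, ⟨h1, h2, h3⟩, -⟩ := h
    exact ⟨p, by omega, by omega, hsymm _ _ ((hS _ _).1 h3).2⟩
  · obtain ⟨-, ⟨h1, h3⟩, -⟩ := h
    exact ⟨q, by omega, ((hS _ _).1 h3).2⟩

theorem exists_candidate_of_leftChild {S : Set (IsoClass k n)} {R : ℤ → ℤ → Prop}
    (hR : IsStrandRel S R) {i j p q : Fin (n + 1)} {d : Letter} (h : LeftChild S i j d p q) :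
    ∃ x, Candidate R (-1) j i d x := by
  obtain ⟨hsymm, -, hS⟩ := hR
  cases d
  · obtain ⟨-, ⟨h1, h2, h3⟩, -⟩ := h
    exact ⟨p, by omega, by omega, hsymm _ _ ((hS _ _).1 h3).2⟩
  · obtain ⟨-, ⟨h1, h2, h3⟩, -⟩ := h
    exact ⟨q, by omega, by omega, ((hS _ _).1 h3).2⟩
  · obtain ⟨-, ⟨h1, h3⟩, -⟩ := h
    exact ⟨p, by omega, hsymm _ _ ((hS _ _).1 h3).2⟩

/-! ### The exceptional set of a tree, and the bijection. -/

/-- The set of objects that the tree `T` describes. -/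
def treeSet (k : Type u) [Field k] (n : ℕ) (T : TernaryTree) : Set (IsoClass k n) :=
  {X | ∃ i j : Fin (n + 1), ((i : ℤ), (j : ℤ)) ∈ T.arcs 1 0 ∧ X = M k i j}

theorem exists_fin_of_mem_arcs {T : TernaryTree} (hT : T.numNodes = n) {X : ℤ × ℤ}
    (hX : X ∈ T.arcs 1 0) : ∃ i j : Fin (n + 1), i < j ∧ X = ((i : ℤ), (j : ℤ)) := by
  have := TernaryTree.arcs_bounds (.inl rfl) hX
  refine ⟨⟨X.1.toNat, by omega⟩, ⟨X.2.toNat, by omega⟩, ?_, Prod.ext ?_ ?_⟩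
  · rw [Fin.mk_lt_mk]; omega
  · simp only; omega
  · simp only; omega

theorem strand_treeSet {T : TernaryTree} {i j : Fin (n + 1)} :
    Strand (treeSet k n T) i j ↔ ((i : ℤ), (j : ℤ)) ∈ T.arcs 1 0 := by
  constructor
  · rintro ⟨hij, p, q, hpq, h⟩
    have := (TernaryTree.arcs_bounds (.inl rfl) hpq).1
    obtain ⟨rfl, rfl⟩ := M_injective hij (by simp only at this; omega) h
    exact hpq
  · intro h
    have := (TernaryTree.arcs_bounds (.inl rfl) h).1
    exact ⟨by simp only at this; omega, i, j, h, rfl⟩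

theorem arc_eq_arc {p q : ℤ × ℤ} (h : arc p = arc q) : p = q ∨ p = (q.2, q.1) := by
  simp only [arc, Prod.mk.injEq] at h
  rcases le_total q.1 q.2 with h' | h' <;> rcases le_total p.1 p.2 with h'' | h''
  · exact .inl (Prod.ext (by omega) (by omega))
  · exact .inr (Prod.ext (by simp only; omega) (by simp only; omega))
  · exact .inr (Prod.ext (by simp only; omega) (by simp only; omega))
  · exact .inl (Prod.ext (by omega) (by omega))

theorem arc_swap (p q : ℤ) : arc (p, q) = arc (q, p) := by
  simp only [arc, min_comm, max_comm]

theorem arc_of_lt {p q : ℤ} (h : p < q) : arc (p, q) = (p, q) := by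
  simp only [arc, min_eq_left h.le, max_eq_right h.le]

/-- Two vertices are joined by a strand of the tree `T`. -/
def treeRel (T : TernaryTree) (p q : ℤ) : Prop := arc (p, q) ∈ T.arcs 1 0

theorem isStrandRel_treeRel {T : TernaryTree} (hT : T.numNodes = n) :
    IsStrandRel (treeSet k n T) (treeRel T) := by
  refine ⟨fun p q h => by rwa [treeRel, arc_swap], fun p q h => ?_, fun i j => ?_⟩
  · have := TernaryTree.arcs_bounds (.inl rfl) h
    simp only [arc] at this
    omega
  · rw [strand_treeSet]
    constructor
    · intro h
      have := (TernaryTree.arcs_bounds (.inl rfl) h).1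
      simp only at this
      exact ⟨by omega, by rwa [treeRel, arc_of_lt this]⟩
    · rintro ⟨hij, h⟩
      rwa [treeRel, arc_of_lt (by omega)] at h

theorem draws_treeRel (T : TernaryTree) : T.Draws 1 0 (treeRel T) := by
  refine ⟨fun w hw => TernaryTree.mem_arcs.2 ⟨w, hw, rfl⟩, fun p q h _ _ => ?_⟩
  obtain ⟨w, hw, h⟩ := TernaryTree.mem_arcs.1 h
  exact ⟨w, hw, arc_eq_arc h⟩

theorem dist_strandGraph_treeSet {T : TernaryTree} (hT : T.numNodes = n) (v : Fin (n + 1)) :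
    (strandGraph (treeSet k n T)).dist 0 v = T.depth 1 0 v := by
  have hadj : ∀ u v, (strandGraph (treeSet k n T)).Adj u v ↔ treeRel T u v := by
    intro u v
    obtain ⟨hsymm, -, hS⟩ := isStrandRel_treeRel (k := k) hT
    constructor
    · rintro (h | h)
      · exact ((hS _ _).1 h).2
      · exact hsymm _ _ ((hS _ _).1 h).2
    · intro h
      rcases lt_trichotomy u v with h' | rfl | h'
      · exact .inl ((hS _ _).2 ⟨h', h⟩)
      · have := (TernaryTree.arcs_bounds (.inl rfl) h).1
        simp [arc] at this
      · exact .inr ((hS _ _).2 ⟨h', hsymm _ _ h⟩)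
  refine dist_eq_of_parent (d := fun v : Fin (n + 1) => T.depth 1 0 v) (T.depth_self 1 0)
    (fun u v huv => ?_) (fun v hv => ?_) v
  · obtain ⟨w, hw, h⟩ := TernaryTree.mem_arcs.1 ((hadj _ _).1 huv)
    have hd := T.depth_label (.inl rfl) 0 hw
    rcases arc_eq_arc h with h | h <;> rw [h] at hd <;> simp only at hd ⊢ <;> omega
  · have hv0 : v.1 ≠ 0 := fun h => hv (Fin.ext h)
    obtain ⟨w, hw, h⟩ := T.exists_label_snd_eq (.inl rfl) 0 v (by omega) (by omega)
    have hb := T.label_bounds (.inl rfl) 0 hw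
    have hd := T.depth_label (.inl rfl) 0 hw
    have h1 := (draws_treeRel T).1 w hw
    obtain ⟨u, hu⟩ : ∃ u : Fin (n + 1), (T.label 1 0 w).1 = u :=
      ⟨⟨(T.label 1 0 w).1.toNat, by omega⟩, by simp only; omega⟩
    rw [hu, h] at hd h1
    exact ⟨u, (hadj _ _).2 h1, hd⟩

theorem exists_labelling {T : TernaryTree} (hT : T.numNodes = n) :
    ∃ ℓ : T.Node ≃ treeSet k n T, IsChildrenLabelling (treeSet k n T) T ℓ := by
  have hmem : ∀ w : T.Node, ∃ i j : Fin (n + 1), i < j ∧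
      arc (T.label 1 0 w.1) = ((i : ℤ), (j : ℤ)) := fun w =>
    exists_fin_of_mem_arcs hT (TernaryTree.mem_arcs.2 ⟨w.1, w.2, rfl⟩)
  choose src tgt hlt harc using hmem
  have hin : ∀ w : T.Node, M k (src w) (tgt w) ∈ treeSet k n T := fun w =>
    ⟨src w, tgt w, TernaryTree.mem_arcs.2 ⟨w.1, w.2, harc w⟩, rfl⟩
  have hbij : Function.Bijective
      (fun w : T.Node => (⟨M k (src w) (tgt w), hin w⟩ : treeSet k n T)) := by
    constructor
    · intro w w' h
      obtain ⟨h1, h2⟩ := M_injective (hlt w) (hlt w') (congrArg Subtype.val h)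
      have hd := T.depth_label (.inl rfl) 0 w.2
      have hd' := T.depth_label (.inl rfl) 0 w'.2
      -- The same strand with its ends exchanged is impossible: the far end is always one deeper
      -- than the near end.
      rcases arc_eq_arc ((harc w).trans ((h1 ▸ h2 ▸ rfl : _ = _).trans (harc w').symm)) with h | h
      · exact Subtype.ext (T.label_snd_injective (.inl rfl) 0 w.2 w'.2 (congrArg Prod.snd h))
      · rw [h] at hd
        simp only at hd
        omega
    · rintro ⟨X, i, j, hij, rfl⟩
      obtain ⟨w, hw, h⟩ := TernaryTree.mem_arcs.1 hij
      refine ⟨⟨w, hw⟩, Subtype.ext ?_⟩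
      have := (harc ⟨w, hw⟩).symm.trans h
      simp only [Prod.mk.injEq, Nat.cast_inj] at this
      exact congrArg₂ (M k) (Fin.ext this.1) (Fin.ext this.2)
  have hR := isStrandRel_treeRel (k := k) hT
  refine ⟨Equiv.ofBijective _ hbij, fun h => ?_, fun w d Y => ?_⟩
  · have h0 := T.label_nil_fst 1 0
    have hb := T.label_bounds (.inl rfl) 0 h
    have ha := harc ⟨[], h⟩
    simp only [arc, Prod.mk.injEq] at ha
    refine ⟨tgt ⟨[], h⟩, ⟨?_, fun x hx => ?_⟩, ?_⟩
    · refine strand_treeSet.2 (TernaryTree.mem_arcs.2 ⟨[], h, (harc ⟨[], h⟩).trans ?_⟩)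
      rw [Prod.mk.injEq]
      refine ⟨?_, rfl⟩
      rw [Fin.val_zero]
      omega
    · obtain ⟨w, hw, hx⟩ := TernaryTree.mem_arcs.1 (strand_treeSet.1 hx)
      have hbw := T.label_bounds (.inl rfl) 0 hw
      simp only [arc, Prod.mk.injEq, Fin.val_zero] at hx
      have := T.label_snd_le (.inl rfl) 0 hw (by omega)
      omega
    · change M k (src ⟨[], h⟩) _ = _
      congr 1
      refine Fin.ext ?_
      rw [Fin.val_zero]
      omega
  · obtain ⟨τ, u, v, hτ, hl, huv, hnode, hcand⟩ :=
      TernaryTree.label_child (.inl rfl) hR.1 (draws_treeRel T) w.2 d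
    have hdep := T.depth_label (.inl rfl) 0 w.2
    have ha := harc w
    rw [hl] at hdep ha
    simp only at hdep
    rw [arc, Prod.mk.injEq] at ha
    simp only at ha
    have hS : Strand (treeSet k n T) (src w) (tgt w) :=
      strand_treeSet.2 (TernaryTree.mem_arcs.2 ⟨w.1, w.2, harc w⟩)
    have hdist := dist_strandGraph_treeSet (k := k) hT
    have back : ∀ Y : treeSet k n T, (∃ h : T.IsNode (w.1 ++ [d]),
        (Equiv.ofBijective _ hbij) ⟨w.1 ++ [d], h⟩ = Y) →
        IsChild (treeSet k n T) d ((Equiv.ofBijective _ hbij) w).1 Y.1 := by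
      rintro _ ⟨h, rfl⟩
      obtain ⟨x, hlx, hx, hbest⟩ := hnode h
      have hax := (harc ⟨_, h⟩).symm
      rw [hlx] at hax
      refine ⟨src w, tgt w, src ⟨_, h⟩, tgt ⟨_, h⟩, hS, rfl, rfl, ?_⟩
      rcases hτ with rfl | rfl
      · obtain ⟨rfl, rfl⟩ : u = src w ∧ v = tgt w := by omega
        refine .inr ⟨?_, rightChild_of_better hR (hlt w) hx hbest hax⟩
        rw [OrientedRight, hdist, hdist]
        omega
      · obtain ⟨rfl, rfl⟩ : u = tgt w ∧ v = src w := by omega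
        refine .inl ⟨?_, leftChild_of_better hR (hlt w) hx hbest hax⟩
        rw [OrientedLeft, hdist, hdist]
        omega
    refine ⟨fun hY => ?_, back Y⟩
    have hn : T.IsNode (w.1 ++ [d]) := by
      obtain ⟨i, j, p, q, hij, hM, -, h⟩ := id hY
      obtain ⟨rfl, rfl⟩ := M_injective (hlt w) hij.1 hM
      rcases hτ with rfl | rfl
      · obtain ⟨rfl, rfl⟩ : u = src w ∧ v = tgt w := by omega
        rcases h with ⟨ho, h⟩ | ⟨ho, h⟩
        · rw [OrientedLeft, hdist, hdist] at ho
          omega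
        · obtain ⟨x, hx⟩ := exists_candidate_of_rightChild hR h
          exact hcand x hx
      · obtain ⟨rfl, rfl⟩ : u = tgt w ∧ v = src w := by omega
        rcases h with ⟨ho, h⟩ | ⟨ho, h⟩
        · obtain ⟨x, hx⟩ := exists_candidate_of_leftChild hR h
          exact hcand x hx
        · rw [OrientedRight, hdist, hdist] at ho
          omega
    -- The label of the node `wd` is a child as well, and children are unique.
    exact ⟨hn, Subtype.ext (isChild_unique (back _ ⟨hn, rfl⟩) hY)⟩

theorem isExceptionalSet_treeSet {T : TernaryTree} (hT : T.numNodes = n) :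
    IsExceptionalSet (treeSet k n T) := by
  have hlen : (T.arcs 1 0).length = n := (T.length_arcs 1 0).trans hT
  choose src tgt hlt harc using fun m : Fin n =>
    exists_fin_of_mem_arcs hT (List.getElem_mem (l := T.arcs 1 0) (n := m) (by omega))
  have hpair := List.pairwise_iff_getElem.1 (T.pairwise_arcs (.inl rfl) 0)
  have hblock : ∀ a b : Fin n, b < a →
      ¬ Blocks ((src b : ℤ), (tgt b : ℤ)) ((src a : ℤ), (tgt a : ℤ)) := fun a b hab => by
    rw [← harc, ← harc]
    exact hpair b a (by omega) (by omega) hab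
  refine ⟨fun m => intervalRep k n (src m) (tgt m), ⟨fun m => ?_, fun a b hab => ?_,
    fun a b hab => ?_⟩, Set.ext fun X => ?_⟩
  · exact isExceptional_intervalRep (hlt m) (by omega)
  · refine subsingleton_hom_intervalRep (hlt a) (by omega) (by omega) fun h => ?_
    exact hblock a b hab (.inl (by simp only; omega))
  · refine subsingleton_ext_intervalRep (hlt a) (by omega) fun h => ?_
    exact hblock a b hab (.inr (by simp only; omega))
  · constructor
    · rintro ⟨i, j, hij, rfl⟩
      obtain ⟨m, hm, h⟩ := List.getElem_of_mem hij
      have := (harc ⟨m, by omega⟩).symm.trans h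
      simp only [Prod.mk.injEq, Nat.cast_inj] at this
      exact ⟨⟨m, by omega⟩, congrArg₂ (M k) (Fin.ext this.1) (Fin.ext this.2)⟩
    · rintro ⟨m, rfl⟩
      refine ⟨src m, tgt m, ?_, rfl⟩
      rw [← harc]
      exact List.getElem_mem _

/-- The intervals in the sequence give `n` arcs inside `[0, n]`, ordered by position, which is the
extremal case of `drawable`. -/
theorem exists_treeSet_eq {S : Set (IsoClass k n)} (hS : IsExceptionalSet S) :
    ∃ T : TernaryTree, T.numNodes = n ∧ treeSet k n T = S := by
  obtain ⟨V, hV, rfl⟩ := hS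
  choose i j hij hj e using fun m => (hV.exceptional m).exists_iso_intervalRep
  replace e := fun m => (e m).some
  have hom : ∀ a b, b < a → Subsingleton
      (intervalRep k n (i a) (j a) ⟶ intervalRep k n (i b) (j b)) := fun a b hab =>
    subsingleton_hom_of_iso (e a) (e b) (hV.hom_eq_zero a b hab)
  have ext : ∀ a b, b < a → Subsingleton
      (Abelian.Ext.{u + 1} (intervalRep k n (i a) (j a)) (intervalRep k n (i b) (j b)) 1) :=
    fun a b hab => subsingleton_ext_of_iso (e a) (e b) (hV.ext_eq_zero a b hab)
  have hblock : ∀ a b, b < a → ¬ Blocks ((i b : ℤ), (j b : ℤ)) ((i a : ℤ), (j a : ℤ)) := by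
    rintro a b hab (h | h) <;> simp only at h
    · exact not_subsingleton_hom_intervalRep (hij a) (hj a) (by omega) (hom a b hab)
    · exact not_subsingleton_ext_intervalRep (hij a) (hj b) (by omega) (ext a b hab)
  let f : Fin n → ℤ × ℤ := fun m => (i m, j m)
  -- An arc blocks itself, through the identity morphism, so the sequence has no repetition.
  have hself : ∀ m, Blocks (f m) (f m) := fun m =>
    .inl ⟨le_rfl, by have := hij m; simp only [f]; omega, le_rfl⟩
  have hf : Function.Injective f := by
    intro a b hab
    rcases lt_trichotomy a b with h | h | h
    · exact (hblock b a h (show Blocks (f a) (f b) from hab ▸ hself a)).elim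
    · exact h
    · exact (hblock a b h (show Blocks (f b) (f a) from hab ▸ hself a)).elim
  have hI : Inside (Finset.univ.image f) 0 (0 + n) := by
    intro X hX
    obtain ⟨m, -, rfl⟩ := Finset.mem_image.1 hX
    have := hij m
    have := hj m
    simp only [f]
    omega
  have hO : Orderable (Finset.univ.image f) := by
    refine ⟨Function.extend f (fun m => (m : ℤ)) 0, fun X hX Y hY hne hB => ?_⟩
    obtain ⟨a, -, rfl⟩ := Finset.mem_image.1 hX
    obtain ⟨b, -, rfl⟩ := Finset.mem_image.1 hY
    rw [hf.extend_apply, hf.extend_apply]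
    rcases lt_trichotomy a b with h | rfl | h
    · exact (hblock b a h hB).elim
    · exact (hne rfl).elim
    · omega
  have hcard : (Finset.univ.image f).card = n := by
    rw [Finset.card_image_of_injective _ hf, Finset.card_fin]
  obtain ⟨⟨T, hT, hmem⟩, -⟩ := (drawable n 0 _ hI hO).2 hcard
  refine ⟨T, hT, Set.ext fun X => ⟨?_, ?_⟩⟩
  · rintro ⟨p, q, hpq, rfl⟩
    obtain ⟨m, -, hm⟩ := Finset.mem_image.1 ((hmem _).2 hpq)
    simp only [f, Prod.mk.injEq, Nat.cast_inj] at hm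
    refine ⟨m, Quotient.sound ⟨?_⟩⟩
    rw [← hm.1, ← hm.2]
    exact e m
  · rintro ⟨m, rfl⟩
    have := hij m
    have := hj m
    exact ⟨⟨i m, by omega⟩, ⟨j m, by omega⟩,
      (hmem _).1 (Finset.mem_image.2 ⟨m, Finset.mem_univ _, rfl⟩), Quotient.sound ⟨e m⟩⟩

/-- Equal sets carry labellings by both trees, and a set determines the tree of its labelling. -/
theorem treeSet_injective {T T' : TernaryTree} (hT : T.numNodes = n) (hT' : T'.numNodes = n)
    (h : treeSet k n T = treeSet k n T') : T = T' := by
  obtain ⟨ℓ, hℓ⟩ := exists_labelling (k := k) hT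
  have hex := exists_labelling (k := k) hT'
  rw [← h] at hex
  obtain ⟨ℓ', hℓ'⟩ := hex
  exact hℓ.tree_eq hℓ'

end

end StraightA

theorem mainTheorem11 (k : Type u) [Field k] (n : ℕ) :
    ∃ Φ : {S : Set (StraightA.IsoClass k n) // StraightA.IsExceptionalSet S} ≃
        {T : StraightA.TernaryTree // T.numNodes = n},
      ∀ S : {S : Set (StraightA.IsoClass k n) // StraightA.IsExceptionalSet S},
        (Φ S).1.numLeaves = 2 * n + 1 ∧
        ∃! ℓ : (Φ S).1.Node ≃ S.1, StraightA.IsChildrenLabelling S.1 (Φ S).1 ℓ := by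
  let Ψ : {T : StraightA.TernaryTree // T.numNodes = n} →
      {S : Set (StraightA.IsoClass k n) // StraightA.IsExceptionalSet S} :=
    fun T => ⟨StraightA.treeSet k n T.1, StraightA.isExceptionalSet_treeSet T.2⟩
  have hΨ : Function.Bijective Ψ := by
    refine ⟨fun T T' h => Subtype.ext ?_, fun S => ?_⟩
    · exact StraightA.treeSet_injective T.2 T'.2 (congrArg Subtype.val h)
    · obtain ⟨T, hT, h⟩ := StraightA.exists_treeSet_eq S.2
      exact ⟨⟨T, hT⟩, Subtype.ext h⟩
  refine ⟨(Equiv.ofBijective Ψ hΨ).symm, fun S => ?_⟩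
  obtain ⟨T, rfl⟩ := hΨ.2 S
  rw [Equiv.ofBijective_symm_apply_apply]
  refine ⟨by rw [StraightA.TernaryTree.numLeaves_eq, T.2], ?_⟩
  obtain ⟨ℓ, hℓ⟩ := StraightA.exists_labelling (k := k) T.2
  exact ⟨ℓ, hℓ, fun ℓ' hℓ' => hℓ'.unique hℓ⟩
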